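/- Let $\Omega$ be a countably infinite set and let $E=\mathrm{Self}(\Omega)$ be the monoid of all maps $\Omega\to\Omega$ under composition, with the function topology (the product topology on $\Omega^\Omega$, where $\Omega$ is discrete). For submonoids $M_1,M_2\subseteq E$ write $M_1\preccurlyeq M_2$ if there is a finite set $U\subseteq E$ such that $M_1$ is contained in the submonoid $\langle M_2\cup U\rangle$ generated by $M_2\cup U$, and write $M_1\approx M_2$ if $M_1\preccurlyeq M_2$ and $M_2\preccurlyeq M_1$. For a submonoid $M\subseteq E$, $\Sigma\subseteq\Omega$ and $\alpha\in\Omega$, let $M_{(\Sigma)}=\{f\in M: f \text{ fixes every element of } \Sigma\}$ and let $(\alpha)M$, the forward orbit of $\alpha$ under $M$, be the set of images of $\alpha$ under the elements of $M$. Say that $M$ has large stabilizers if $M_{(\Sigma)}\approx M$ for every finite $\Sigma\subseteq\Omega$, and that $M$ has dense a.e. injective maps if those $f\in M$ that are injective on the complement of some finite set form a dense subset of $M$. Call $M$ admissible if it is closed in the function topology, has large stabilizers and has dense a.e. injective maps. Fix an enumeration $e:\Omega\to\omega$ (a bijection), a partition $A$ of $\Omega$ into $2$-element sets, and $\gamma\in\Omega$.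 Let $E_\le$ be the monoid of all $f\in E$ such that $e((\alpha)f)\le e(\alpha)$ for all $\alpha\in\Omega$; let $E_{(A)}$ be the monoid of all $f\in E$ that map each member of $A$ into itself; and let $E(\rho_\gamma)$ be the monoid of all $f\in E$ such that $(\alpha)f\in\{\alpha,\gamma\}$ for all $\alpha\in\Omega$. **Theorem.** The five monoids $E,\ E_\le,\ E_{(A)},\ E(\rho_\gamma),\ \{1\}$ are admissible and pairwise inequivalent with respect to $\approx$. Let $M\subseteq E$ be any admissible submonoid. Then $M$ is $\approx$-equivalent to exactly one of these five monoids. Moreover, $M$ satisfies exactly one of the following five conditions, and $M$ is equivalent to $E$, $E_\le$, $E_{(A)}$, $E(\rho_\gamma)$, $\{1\}$ if and only if it satisfies (i), (ii), (iii), (iv), (v), respectively: (i) $M_{(\Sigma)}$ has an infinite forward orbit for every finite $\Sigma\subseteq\Omega$. (ii) There exists a finite set $\Sigma\subseteq\Omega$ such that all forward orbits of $M_{(\Sigma)}$ are finite, but for every finite $\Sigma\subseteq\Omega$ the cardinalities of the forward orbits of $M_{(\Sigma)}$ have no common finite bound. (iii) There exist a finite set $\Sigma\subseteq\Omega$ and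 a positive integer $n$ such that the cardinalities of all forward orbits of $M_{(\Sigma)}$ are bounded by $n$, but for all finite $\Gamma,\Delta\subseteq\Omega$ there exists $\alpha\in\Omega$ such that $(\alpha)M_{(\Delta)}\not\subseteq\Gamma\cup\{\alpha\}$. (iv) There exist finite sets $\Gamma,\Delta\subseteq\Omega$ such that $(\alpha)M_{(\Delta)}\subseteq\Gamma\cup\{\alpha\}$ for all $\alpha\in\Omega$, but $M_{(\Sigma)}\neq\{1\}$ for every finite $\Sigma\subseteq\Omega$. (v) There exists a finite set $\Sigma\subseteq\Omega$ such that $M_{(\Sigma)}=\{1\}$. -/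

import Mathlib

namespace SelfMap

/-! Self-maps of `Ω` form the monoid `Function.End Ω`, in which `f * g = f ∘ g`. -/

/-- `M₁ ≼ M₂`: the submonoid `M₁` lies in the submonoid generated by `M₂` and a finite set. -/
def Preceq {E : Type*} [Monoid E] (M₁ M₂ : Submonoid E) : Prop :=
  ∃ U : Set E, U.Finite ∧ M₁ ≤ Submonoid.closure ((M₂ : Set E) ∪ U)

/-- `M₁ ≈ M₂`: both `M₁ ≼ M₂` and `M₂ ≼ M₁`. -/
def Approx {E : Type*} [Monoid E] (M₁ M₂ : Submonoid E) : Prop :=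
  Preceq M₁ M₂ ∧ Preceq M₂ M₁

variable {Ω : Type*}

/-- The function topology: the product topology on `Ω → Ω`, where `Ω` is discrete. -/
abbrev functionTopology (Ω : Type*) : TopologicalSpace (Function.End Ω) :=
  @Pi.topologicalSpace Ω (fun _ => Ω) (fun _ => ⊥)

/-- `M_(Σ)`: the elements of `M` that fix every point of `S`. -/
def stab (M : Submonoid (Function.End Ω)) (S : Set Ω) : Submonoid (Function.End Ω) :=
  M ⊓ fixingSubmonoid (Function.End Ω) S

/-- The forward orbit `{f α : f ∈ M}` of `α` under `M`. -/
def forwardOrbit (M : Submonoid (Function.End Ω)) (α : Ω) : Set Ω :=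
  {β | ∃ f ∈ M, f α = β}

/-- `M` is closed in the function topology. -/
def IsClosedSubmonoid (M : Submonoid (Function.End Ω)) : Prop :=
  @IsClosed _ (functionTopology Ω) (M : Set (Function.End Ω))

/-- `M` has large stabilizers: `M_(Σ) ≈ M` for every finite `Σ`. -/
def HasLargeStabilizers (M : Submonoid (Function.End Ω)) : Prop :=
  ∀ S : Finset Ω, Approx (stab M (S : Set Ω)) M

/-- `f` is injective off a finite set. -/
def AEInjective (f : Function.End Ω) : Prop :=
  ∃ Γ : Finset Ω, Set.InjOn f ((Γ : Set Ω)ᶜ)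

/-- The a.e. injective elements of `M` are dense in `M` for the function topology. -/
def HasDenseAEInjective (M : Submonoid (Function.End Ω)) : Prop :=
  (M : Set (Function.End Ω)) ⊆
    @closure _ (functionTopology Ω) {f : Function.End Ω | f ∈ M ∧ AEInjective f}

/-- The submonoids to be classified. -/
structure Admissible (M : Submonoid (Function.End Ω)) : Prop where
  closed : IsClosedSubmonoid M
  largeStabilizers : HasLargeStabilizers M
  denseAEInjective : HasDenseAEInjective M

/-- `E(ρ)`, for a preorder `ρ`: all maps `f` with `(α, f α) ∈ ρ` for every `α`. -/
def preorderMonoid (ρ : Ω → Ω → Prop) (hrefl : ∀ α, ρ α α)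
    (htrans : ∀ α β δ, ρ α β → ρ β δ → ρ α δ) : Submonoid (Function.End Ω) where
  carrier := {f | ∀ α, ρ α (f α)}
  one_mem' := fun α => hrefl α
  mul_mem' := fun {f g} hf hg α => htrans α (g α) (f (g α)) (hg α) (hf (g α))

/-- `E_≤`, transported to `Ω` along an enumeration `e` of `Ω`: the maps that are (weakly)
decreasing for the ordering of `Ω` induced by that of the natural numbers. -/
def decreasingMonoid (e : Ω ≃ ℕ) : Submonoid (Function.End Ω) :=
  preorderMonoid (fun α β => e β ≤ e α) (fun _ => le_rfl) (fun _ _ _ h₁ h₂ => h₂.trans h₁)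

/-- `E_(A)`: the maps that send every member of `A` into itself. -/
def partitionMonoid (A : Set (Set Ω)) : Submonoid (Function.End Ω) where
  carrier := {f | ∀ s ∈ A, Set.MapsTo f s s}
  one_mem' := fun _ _ _ hx => hx
  mul_mem' := fun hf hg s hs _ hx => hf s hs (hg s hs hx)

/-- The preorder `ρ_γ`: `(α, β) ∈ ρ_γ` if and only if `β ∈ {α, γ}`. -/
def rho (γ : Ω) (α β : Ω) : Prop := β = α ∨ β = γ

/-- `E(ρ_γ)`. -/
def rhoMonoid (γ : Ω) : Submonoid (Function.End Ω) :=
  preorderMonoid (rho γ) (fun _ => Or.inl rfl) (by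
    rintro α β δ h₁ (rfl | rfl)
    · exact h₁
    · exact Or.inr rfl)

/-- The five representatives `E`, `E_≤`, `E_(A)`, `E(ρ_γ)`, `{1}`. -/
def representative (e : Ω ≃ ℕ) (A : Set (Set Ω)) (γ : Ω) :
    Fin 5 → Submonoid (Function.End Ω) :=
  ![⊤, decreasingMonoid e, partitionMonoid A, rhoMonoid γ, ⊥]

/-- Every `M_(Σ)`, `Σ` finite, has an infinite forward orbit. -/
def CondI (M : Submonoid (Function.End Ω)) : Prop :=
  ∀ S : Finset Ω, ∃ α, (forwardOrbit (stab M (S : Set Ω)) α).Infinite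

/-- Some `M_(Σ)` has only finite forward orbits, but for no finite `Σ` is there a common finite
bound on the cardinalities of the forward orbits of `M_(Σ)`. -/
def CondII (M : Submonoid (Function.End Ω)) : Prop :=
  (∃ S : Finset Ω, ∀ α, (forwardOrbit (stab M (S : Set Ω)) α).Finite) ∧
  ∀ S : Finset Ω, ¬ ∃ n : ℕ, ∀ α, (forwardOrbit (stab M (S : Set Ω)) α).encard ≤ n

/-- Some `M_(Σ)` has forward orbits of bounded cardinality, but for all finite `Γ`, `Δ` there is
an `α` whose forward orbit under `M_(Δ)` is not contained in `Γ ∪ {α}`. -/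
def CondIII (M : Submonoid (Function.End Ω)) : Prop :=
  (∃ (S : Finset Ω) (n : ℕ), 0 < n ∧
    ∀ α, (forwardOrbit (stab M (S : Set Ω)) α).encard ≤ n) ∧
  ∀ Γ Δ : Finset Ω, ∃ α, ¬ forwardOrbit (stab M (Δ : Set Ω)) α ⊆ (Γ : Set Ω) ∪ {α}

/-- For some finite `Γ`, `Δ` the forward orbit of every `α` under `M_(Δ)` is contained in
`Γ ∪ {α}`, but no `M_(Σ)`, `Σ` finite, is trivial. -/
def CondIV (M : Submonoid (Function.End Ω)) : Prop :=
  (∃ Γ Δ : Finset Ω, ∀ α, forwardOrbit (stab M (Δ : Set Ω)) α ⊆ (Γ : Set Ω) ∪ {α}) ∧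
  ∀ S : Finset Ω, stab M (S : Set Ω) ≠ ⊥

/-- Some `M_(Σ)`, `Σ` finite, is trivial. -/
def CondV (M : Submonoid (Function.End Ω)) : Prop :=
  ∃ S : Finset Ω, stab M (S : Set Ω) = ⊥

/-- The five conditions, in order. -/
def Condition (M : Submonoid (Function.End Ω)) : Fin 5 → Prop :=
  ![CondI M, CondII M, CondIII M, CondIV M, CondV M]

end SelfMap

/-!
Lower and upper bounds for `≼` are proved separately for each of the five conditions.

*Upper bounds.* If `M_(Σ)` has finite forward orbits, its elements are maps whose value at `α` lies
in a prescribed finite set. Such maps become decreasing after a sparse reindexing of the domain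
(`generatedOver_decreasingMonoid`); if the sets have bounded size, then the value can be selected by
boundedly many binary choices (`generatedOver_fibreMonoid_of_encard_le`); if the only values
other than `α` lie in a fixed finite set of fixed points, then these can be treated one at a time
(`generatedOver_rhoMonoid`). Since `M ≈ M_(Σ)`, this bounds `M`.

*Lower bounds.* These need only that `M` is closed and has dense a.e. injective maps. One constructs
points `α₀, α₁, …` and a tree of a.e. injective elements of `M`, where a map of level `r + 1` arises
from one of level `r` by precomposition with an element that fixes a growing finite set and moves
`α_r`. Branches converge as `M` is closed. The images of `α_r` are arranged so that one map `t`
reads off from them which child was taken; with `s` sending the `r`-th point to `α_r`, the maps `t g s`,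
`g ∈ M`, then include all maps with prescribed sets of values. Almost everywhere injectivity
ensures that a map of level `r` does not destroy the orbit of a well chosen `α_r`. The fusion is
`exists_sandwich_of_finite_choices` when there are finitely many children, and
`exists_sandwich_of_infinite_orbits` when there are infinitely many. The combinatorial input is
Hall's theorem for condition (ii), a minimality argument making the maps permute an orbit for
(iii), and the pigeonhole principle for (iv).

Each representative satisfies its own condition, and so do its pointwise stabilizers, so the lower
bounds also show that the representatives have large stabilizers. Inequivalence follows by counting
and diagonalization: words of length `k` can move a point only to a controlled set of places
(`exists_forall_mem_reach`), words over `E(ρ_γ)` and a finite set that are injective agree almost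
everywhere with one of countably many maps (`exists_word_of_mem_closure_rhoMonoid`), and finitely
generated monoids are countable. The five conditions partition all monoids by pure logic, so the
remaining implications are formal.
-/

namespace SelfMap

/-! ### Relative generation over a submonoid -/

section Generation

variable {E : Type*} [Monoid E]

/-- `S` lies in the submonoid generated by `M` and finitely many further elements. For a submonoid
`S` this is `Preceq S M`; the version for sets can be applied to factors of products. -/
def GeneratedOver (S : Set E) (M : Submonoid E) : Prop :=
  ∃ U : Set E, U.Finite ∧ S ⊆ Submonoid.closure ((M : Set E) ∪ U)

theorem GeneratedOver.mono {S T : Set E} {M : Submonoid E} (h : GeneratedOver T M) (hST : S ⊆ T) :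
    GeneratedOver S M := by
  obtain ⟨U, hU, h⟩ := h
  exact ⟨U, hU, hST.trans h⟩

theorem generatedOver_of_le {S : Set E} {M : Submonoid E} (h : S ⊆ M) : GeneratedOver S M :=
  ⟨∅, Set.finite_empty, fun _ hx => Submonoid.subset_closure (Or.inl (h hx))⟩

theorem generatedOver_singleton (a : E) (M : Submonoid E) : GeneratedOver {a} M :=
  ⟨{a}, Set.finite_singleton a, fun _ hx => Submonoid.subset_closure (Or.inr hx)⟩

theorem GeneratedOver.mul {S T R : Set E} {M : Submonoid E} (hS : GeneratedOver S M)
    (hT : GeneratedOver T M) (hR : ∀ r ∈ R, ∃ a ∈ S, ∃ b ∈ T, a * b = r) :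
    GeneratedOver R M := by
  obtain ⟨U, hU, hS⟩ := hS
  obtain ⟨V, hV, hT⟩ := hT
  refine ⟨U ∪ V, hU.union hV, fun r hr => ?_⟩
  obtain ⟨a, ha, b, hb, rfl⟩ := hR r hr
  refine mul_mem (Submonoid.closure_mono ?_ (hS ha)) (Submonoid.closure_mono ?_ (hT hb))
  · exact Set.union_subset_union_right _ Set.subset_union_left
  · exact Set.union_subset_union_right _ Set.subset_union_right

/-- If two fixed elements `s`, `t` turn some element of `M` into any given element of `S`, then
`S` is finitely generated over `M`. -/
theorem generatedOver_of_sandwich {S : Set E} {M : Submonoid E} (s t : E)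
    (h : ∀ f ∈ S, ∃ g ∈ M, t * g * s = f) : GeneratedOver S M := by
  have hM : GeneratedOver (M : Set E) M := generatedOver_of_le subset_rfl
  refine GeneratedOver.mul (S := {x | ∃ g ∈ M, t * g = x})
    (GeneratedOver.mul (generatedOver_singleton t M) hM ?_) (generatedOver_singleton s M) ?_
  · rintro _ ⟨g, hg, rfl⟩
    exact ⟨t, rfl, g, hg, rfl⟩
  · intro f hf
    obtain ⟨g, hg, rfl⟩ := h f hf
    exact ⟨t * g, ⟨g, hg, rfl⟩, s, rfl, rfl⟩

theorem GeneratedOver.trans {S : Set E} {M N : Submonoid E} (h : GeneratedOver S M)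
    (hMN : Preceq M N) : GeneratedOver S N := by
  obtain ⟨U, hU, h⟩ := h
  obtain ⟨V, hV, hMN⟩ := hMN
  refine ⟨U ∪ V, hU.union hV, h.trans ?_⟩
  rw [SetLike.coe_subset_coe, Submonoid.closure_le, Set.union_subset_iff]
  constructor
  · exact fun x hx => Submonoid.closure_mono
      (Set.union_subset_union_right _ Set.subset_union_right) (hMN hx)
  · exact fun x hx => Submonoid.subset_closure (Or.inr (Or.inl hx))

theorem countable_submonoid_closure {S : Set E} (hS : S.Countable) :
    (Submonoid.closure S : Set E).Countable := by
  have : Countable S := hS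
  have : Countable (FreeMonoid S) := inferInstanceAs (Countable (List S))
  rw [Submonoid.closure_eq_mrange]
  exact Set.countable_range _

theorem Preceq.trans {M N K : Submonoid E} (h : Preceq M N) (h' : Preceq N K) : Preceq M K :=
  GeneratedOver.trans (S := (M : Set E)) h h'

theorem Preceq.of_le {M N : Submonoid E} (h : M ≤ N) : Preceq M N :=
  generatedOver_of_le (S := (M : Set E)) h

theorem Approx.symm {M N : Submonoid E} (h : Approx M N) : Approx N M := ⟨h.2, h.1⟩

theorem Approx.trans {M N K : Submonoid E} (h : Approx M N) (h' : Approx N K) : Approx M K :=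
  ⟨h.1.trans h'.1, h'.2.trans h.2⟩

end Generation

/-! ### Pointwise stabilizers and forward orbits -/

variable {Ω : Type*}

theorem mem_stab {M : Submonoid (Function.End Ω)} {S : Set Ω} {f : Function.End Ω} :
    f ∈ stab M S ↔ f ∈ M ∧ ∀ x ∈ S, f x = x := by
  rw [stab, Submonoid.mem_inf, mem_fixingSubmonoid_iff]
  rfl

theorem stab_stab (M : Submonoid (Function.End Ω)) (S T : Set Ω) :
    stab (stab M S) T = stab M (S ∪ T) := by
  ext f
  simp only [mem_stab, Set.mem_union, or_imp, forall_and, and_assoc]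

theorem stab_anti (M : Submonoid (Function.End Ω)) {S T : Set Ω} (h : S ⊆ T) :
    stab M T ≤ stab M S := fun f hf => by
  rw [mem_stab] at hf ⊢
  exact ⟨hf.1, fun x hx => hf.2 x (h hx)⟩

theorem stab_le (M : Submonoid (Function.End Ω)) (S : Set Ω) : stab M S ≤ M := inf_le_left

theorem forwardOrbit_mono {M N : Submonoid (Function.End Ω)} (h : M ≤ N) (α : Ω) :
    forwardOrbit M α ⊆ forwardOrbit N α := by
  rintro _ ⟨f, hf, rfl⟩
  exact ⟨f, h hf, rfl⟩

theorem forwardOrbit_stab_of_mem (M : Submonoid (Function.End Ω)) {S : Set Ω} {α : Ω}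
    (h : α ∈ S) : forwardOrbit (stab M S) α = {α} := by
  ext β
  constructor
  · rintro ⟨f, hf, rfl⟩
    exact (mem_stab.1 hf).2 α h
  · rintro rfl
    exact ⟨1, one_mem _, rfl⟩

/-! ### The function topology -/

/-- A map is in the closure of `X` if and only if on every finite set it agrees with some
element of `X`. -/
theorem mem_closure_functionTopology {X : Set (Function.End Ω)} {f : Function.End Ω} :
    f ∈ @closure _ (functionTopology Ω) X ↔ ∀ S : Finset Ω, ∃ g ∈ X, ∀ x ∈ S, g x = f x := by
  let _ : TopologicalSpace Ω := ⊥
  have : DiscreteTopology Ω := ⟨rfl⟩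
  let _ : TopologicalSpace (Function.End Ω) := functionTopology Ω
  rw [mem_closure_iff]
  constructor
  · intro h S
    have hopen : IsOpen (Set.pi (S : Set Ω) (fun x => ({f x} : Set Ω))) :=
      isOpen_set_pi S.finite_toSet (fun _ _ => isOpen_discrete _)
    obtain ⟨g, hg, hgX⟩ := h _ hopen (fun x _ => rfl)
    exact ⟨g, hgX, fun x hx => hg x hx⟩
  · intro h o ho hfo
    obtain ⟨I, u, hu, hsub⟩ := isOpen_pi_iff.1 ho f hfo
    obtain ⟨g, hgX, hg⟩ := h I
    refine ⟨g, hsub fun x hx => ?_, hgX⟩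
    rw [hg x hx]
    exact (hu x hx).2

theorem IsClosedSubmonoid.mem {M : Submonoid (Function.End Ω)} (hM : IsClosedSubmonoid M)
    {f : Function.End Ω} (h : ∀ S : Finset Ω, ∃ g ∈ M, ∀ x ∈ S, g x = f x) : f ∈ M := by
  have hcl := @IsClosed.closure_eq _ (functionTopology Ω) _ hM
  exact (Set.ext_iff.1 hcl f).1 (mem_closure_functionTopology.2 h)

theorem isClosedSubmonoid_of_mem {M : Submonoid (Function.End Ω)}
    (h : ∀ f : Function.End Ω, (∀ S : Finset Ω, ∃ g ∈ M, ∀ x ∈ S, g x = f x) → f ∈ M) :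
    IsClosedSubmonoid M := by
  refine (@closure_subset_iff_isClosed _ (functionTopology Ω) _).1 fun f hf => ?_
  exact h f (mem_closure_functionTopology.1 hf)

theorem hasDenseAEInjective_iff {M : Submonoid (Function.End Ω)} :
    HasDenseAEInjective M ↔
      ∀ f ∈ M, ∀ S : Finset Ω, ∃ g ∈ M, AEInjective g ∧ ∀ x ∈ S, g x = f x := by
  constructor
  · intro h f hf S
    obtain ⟨g, ⟨hgM, hg⟩, hgS⟩ := mem_closure_functionTopology.1 (h hf) S
    exact ⟨g, hgM, hg, hgS⟩
  · intro h f hf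
    refine mem_closure_functionTopology.2 fun S => ?_
    obtain ⟨g, hgM, hg, hgS⟩ := h f hf S
    exact ⟨g, ⟨hgM, hg⟩, hgS⟩

theorem IsClosedSubmonoid.stab {M : Submonoid (Function.End Ω)} (hM : IsClosedSubmonoid M)
    (S : Set Ω) : IsClosedSubmonoid (stab M S) := by
  refine isClosedSubmonoid_of_mem fun f hf => mem_stab.2 ⟨hM.mem fun T => ?_, fun x hx => ?_⟩
  · obtain ⟨g, hg, hgT⟩ := hf T
    exact ⟨g, (mem_stab.1 hg).1, hgT⟩
  · obtain ⟨g, hg, hgT⟩ := hf {x}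
    rw [← hgT x (Finset.mem_singleton_self x), (mem_stab.1 hg).2 x hx]

theorem HasDenseAEInjective.stab {M : Submonoid (Function.End Ω)} (hM : HasDenseAEInjective M)
    (S : Finset Ω) : HasDenseAEInjective (stab M (S : Set Ω)) := by
  classical
  rw [hasDenseAEInjective_iff] at hM ⊢
  intro f hf T
  obtain ⟨g, hgM, hg, hgS⟩ := hM f (mem_stab.1 hf).1 (S ∪ T)
  refine ⟨g, mem_stab.2 ⟨hgM, fun x hx => ?_⟩, hg, fun x hx => hgS x (Finset.mem_union_right _ hx)⟩
  rw [hgS x (Finset.mem_union_left _ hx), (mem_stab.1 hf).2 x hx]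

/-- A sequence in a closed submonoid whose terms stabilize on an exhausting sequence of finite
sets has a limit in the submonoid. -/
theorem IsClosedSubmonoid.exists_limit {M : Submonoid (Function.End Ω)}
    (hM : IsClosedSubmonoid M) (Γ : ℕ → Finset Ω) (hΓ : Monotone Γ) (hex : ∀ x, ∃ r, x ∈ Γ r)
    (g : ℕ → Function.End Ω) (hg : ∀ r, g r ∈ M) (hagree : ∀ r, ∀ x ∈ Γ r, g (r + 1) x = g r x) :
    ∃ f ∈ M, ∀ r, ∀ x ∈ Γ r, f x = g r x := by
  classical
  have key : ∀ r s, r ≤ s → ∀ x ∈ Γ r, g s x = g r x := by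
    intro r s hrs x hx
    induction s, hrs using Nat.le_induction with
    | base => rfl
    | succ s hrs ih => rw [hagree s x (hΓ hrs hx), ih]
  choose R hR using hex
  have hlim : ∀ r, ∀ x ∈ Γ r, g (R x) x = g r x := by
    intro r x hx
    rcases le_total r (R x) with h | h
    · exact key _ _ h x hx
    · exact (key _ _ h x (hR x)).symm
  refine ⟨fun x => g (R x) x, hM.mem fun S => ⟨g (S.sup R), hg _, fun x hx => ?_⟩, hlim⟩
  exact key _ _ (Finset.le_sup hx) x (hR x)

/-! ### Almost everywhere injective maps -/

theorem AEInjective.finite_preimage {f : Function.End Ω} (hf : AEInjective f) {S : Set Ω}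
    (hS : S.Finite) : (f ⁻¹' S).Finite := by
  obtain ⟨Γ, hΓ⟩ := hf
  have h : (f ⁻¹' S ∩ (Γ : Set Ω)ᶜ).Finite :=
    Set.Finite.of_finite_image (hS.subset (by rintro _ ⟨x, ⟨hx, -⟩, rfl⟩; exact hx))
      (hΓ.mono Set.inter_subset_right)
  refine (Γ.finite_toSet.union h).subset fun x hx => ?_
  by_cases hxΓ : x ∈ (Γ : Set Ω)
  · exact Or.inl hxΓ
  · exact Or.inr ⟨hx, hxΓ⟩

theorem aeInjective_one : AEInjective (1 : Function.End Ω) :=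
  ⟨∅, fun _ _ _ _ h => h⟩

theorem AEInjective.mul {f g : Function.End Ω} (hf : AEInjective f) (hg : AEInjective g) :
    AEInjective (f * g) := by
  classical
  obtain ⟨Δ, hΔ⟩ := id hg
  obtain ⟨Γ, hΓ⟩ := hf
  refine ⟨Δ ∪ (hg.finite_preimage Γ.finite_toSet).toFinset, fun x hx y hy hxy => ?_⟩
  simp only [Finset.coe_union, Set.Finite.coe_toFinset, Set.compl_union, Set.mem_inter_iff,
    Set.mem_compl_iff] at hx hy
  exact hΔ hx.1 hy.1 (hΓ hx.2 hy.2 hxy)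

/-- For finitely many a.e. injective maps and a finite set `S`, there is a finite set outside of
which all the maps are injective and take no value in `S`. -/
theorem exists_common_exceptional_set (W : Finset (Function.End Ω)) (hW : ∀ g ∈ W, AEInjective g)
    (S : Finset Ω) :
    ∃ B : Finset Ω, ∀ g ∈ W, Set.InjOn g ((B : Set Ω)ᶜ) ∧ ∀ x, x ∉ B → g x ∉ S := by
  classical
  induction W using Finset.induction_on with
  | empty => exact ⟨∅, by simp⟩
  | insert a W ha ih =>
    obtain ⟨B, hB⟩ := ih fun g hg => hW g (Finset.mem_insert_of_mem hg)
    have haW := hW a (Finset.mem_insert_self a W)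
    obtain ⟨Γ, hΓ⟩ := id haW
    refine ⟨B ∪ (Γ ∪ (haW.finite_preimage S.finite_toSet).toFinset), fun g hg => ?_⟩
    rcases Finset.mem_insert.1 hg with rfl | hg
    · refine ⟨hΓ.mono ?_, fun x hx hgx => hx ?_⟩
      · intro x hx hxΓ
        exact hx (by simpa using Or.inr (Or.inl hxΓ))
      · exact Finset.mem_union_right _
          (Finset.mem_union_right _ ((Set.Finite.mem_toFinset _).2 hgx))
    · refine ⟨(hB g hg).1.mono ?_, fun x hx => (hB g hg).2 x fun hxB => hx ?_⟩
      · intro x hx hxB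
        exact hx (by simpa using Or.inl hxB)
      · exact Finset.mem_union_left _ hxB

/-! ### Fusion: coding a full product of choice sets into a closed monoid -/

/-- Fusion along a finitely branching tree. Suppose that at every stage, given finitely many a.e.
injective `g ∈ N` and a finite set `Γ`, there is a point `α` such that each `g` can be modified, by
precomposition with some `h` fixing `Γ`, so that the image of `α` encodes any prescribed
`y ∈ C β`; the code is read off by a map `τ` at a point not in `Γ`, or by `t₀` at a point of the
initial set `Γ₀`. Then two fixed maps `s` and `t` turn suitable elements of the closed monoid `N`
into all the maps `f` with `f β ∈ C β`. -/
theorem exists_sandwich_of_finite_choices (e : Ω ≃ ℕ) {N : Submonoid (Function.End Ω)}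
    (hclosed : IsClosedSubmonoid N) (hdense : HasDenseAEInjective N) (C : Ω → Set Ω)
    (hC : ∀ β, (C β).Finite) (Γ₀ : Finset Ω) (t₀ : Ω → Ω)
    (step : ∀ (β : Ω) (Γ : Finset Ω) (W : Finset (Function.End Ω)), Γ₀ ⊆ Γ →
      (∀ g ∈ W, g ∈ N ∧ AEInjective g) →
      ∃ (α : Ω) (τ : Ω → Ω), ∀ g ∈ W, ∀ y ∈ C β, ∃ h ∈ stab N (Γ : Set Ω),
        (g (h α) ∉ Γ ∧ τ (g (h α)) = y) ∨ (g (h α) ∈ Γ₀ ∧ t₀ (g (h α)) = y)) :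
    ∃ s t : Function.End Ω, ∀ f : Function.End Ω, (∀ β, f β ∈ C β) → ∃ g ∈ N, t * g * s = f := by
  classical
  -- A state is a finite set of points on which the limit is already determined, together with
  -- the finitely many approximations constructed so far.
  let State := {p : Finset Ω × Finset (Function.End Ω) //
    Γ₀ ⊆ p.1 ∧ ∀ g ∈ p.2, g ∈ N ∧ AEInjective g}
  have one : ∀ (r : ℕ) (p : State), ∃ (α : Ω) (τ : Ω → Ω) (q : State),
      p.1.1 ⊆ q.1.1 ∧ e.symm r ∈ q.1.1 ∧ α ∈ q.1.1 ∧
      ∀ g ∈ p.1.2, ∀ y ∈ C (e.symm r), ∃ g' ∈ q.1.2, (∀ x ∈ p.1.1, g' x = g x) ∧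
        g' α ∈ q.1.1 ∧
        ((g' α ∉ p.1.1 ∧ τ (g' α) = y) ∨ (g' α ∈ Γ₀ ∧ t₀ (g' α) = y)) := by
    rintro r ⟨⟨Γ, W⟩, hΓ, hW⟩
    obtain ⟨α, τ, hα⟩ := step (e.symm r) Γ W hΓ hW
    have hsel : ∀ g y, ∃ h ∈ stab N (Γ : Set Ω), AEInjective h ∧ (g ∈ W → y ∈ C (e.symm r) →
        (g (h α) ∉ Γ ∧ τ (g (h α)) = y) ∨ (g (h α) ∈ Γ₀ ∧ t₀ (g (h α)) = y)) := by
      intro g y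
      by_cases hgy : g ∈ W ∧ y ∈ C (e.symm r)
      · obtain ⟨h, hh, hcode⟩ := hα g hgy.1 y hgy.2
        obtain ⟨h', hh', hAE, hagree⟩ := hasDenseAEInjective_iff.1 (hdense.stab Γ) h hh {α}
        rw [← hagree α (Finset.mem_singleton_self α)] at hcode
        exact ⟨h', hh', hAE, fun _ _ => hcode⟩
      · exact ⟨1, one_mem _, aeInjective_one, fun h₁ h₂ => absurd ⟨h₁, h₂⟩ hgy⟩
    choose h hstab hAE hcode using hsel
    let W' : Finset (Function.End Ω) :=
      Finset.image₂ (fun g y => g * h g y) W (hC (e.symm r)).toFinset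
    have hW' : ∀ g ∈ W', g ∈ N ∧ AEInjective g := by
      intro g' hg'
      obtain ⟨g, hg, y, hy, rfl⟩ := Finset.mem_image₂.1 hg'
      exact ⟨mul_mem (hW g hg).1 (mem_stab.1 (hstab g y)).1, (hW g hg).2.mul (hAE g y)⟩
    refine ⟨α, τ, ⟨⟨Γ ∪ ({α, e.symm r} ∪ W'.image (fun g => g α)), W'⟩,
      hΓ.trans Finset.subset_union_left, hW'⟩, Finset.subset_union_left, by simp, by simp, ?_⟩
    intro g hg y hy
    have hmem : g * h g y ∈ W' := Finset.mem_image₂_of_mem hg ((hC _).mem_toFinset.2 hy)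
    refine ⟨g * h g y, hmem, fun x hx => ?_, ?_, hcode g y hg hy⟩
    · exact congrArg g ((mem_stab.1 (hstab g y)).2 x hx)
    · exact Finset.mem_union_right _ (Finset.mem_union_right _
        (Finset.mem_image_of_mem (fun g : Function.End Ω => g α) hmem))
  choose a τ nxt hmono hexh ha hnxt using one
  let st : ℕ → State := fun n => Nat.rec
    ⟨(Γ₀, {1}), subset_rfl, fun g hg => by
      rw [Finset.mem_singleton.1 hg]; exact ⟨one_mem _, aeInjective_one⟩⟩ nxt n
  have hst : ∀ r, st (r + 1) = nxt r (st r) := fun _ => rfl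
  have hΓmono : Monotone fun r => (st r).1.1 :=
    monotone_nat_of_le_succ fun r => by rw [hst]; exact hmono r (st r)
  have hex : ∀ x, ∃ r, x ∈ (st (r + 1)).1.1 := fun x => ⟨e x, by
    have := hexh (e x) (st (e x))
    rwa [e.symm_apply_apply] at this⟩
  refine ⟨fun x => a (e x) (st (e x)), fun x => if x ∈ Γ₀ then t₀ x else
    τ (Nat.find (hex x)) (st (Nat.find (hex x))) x, fun f hf => ?_⟩
  have hstep : ∀ (r : ℕ) (g : {g // g ∈ (st r).1.2}), ∃ g' : {g // g ∈ (st (r + 1)).1.2},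
      (∀ x ∈ (st r).1.1, g'.1 x = g.1 x) ∧ g'.1 (a r (st r)) ∈ (st (r + 1)).1.1 ∧
      ((g'.1 (a r (st r)) ∉ (st r).1.1 ∧ τ r (st r) (g'.1 (a r (st r))) = f (e.symm r)) ∨
        (g'.1 (a r (st r)) ∈ Γ₀ ∧ t₀ (g'.1 (a r (st r))) = f (e.symm r))) := by
    rintro r ⟨g, hg⟩
    obtain ⟨g', hg', h⟩ := hnxt r (st r) g hg (f (e.symm r)) (hf _)
    exact ⟨⟨g', hg'⟩, h⟩
  choose up hagree hval hdec using hstep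
  let G : ∀ r, {g // g ∈ (st r).1.2} := fun r =>
    Nat.rec (motive := fun r => {g // g ∈ (st r).1.2}) ⟨1, Finset.mem_singleton_self _⟩ up r
  have hG : ∀ r, G (r + 1) = up r (G r) := fun _ => rfl
  obtain ⟨g, hgN, hg⟩ := hclosed.exists_limit (fun r => (st r).1.1) hΓmono
    (fun x => (hex x).imp' (· + 1) fun _ h => h) (fun r => (G r).1)
    (fun r => ((st r).2.2 _ (G r).2).1) (fun r x hx => by
      simp only [hG]; exact hagree r (G r) x hx)
  refine ⟨g, hgN, funext fun x => ?_⟩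
  obtain ⟨r, rfl⟩ := e.symm.surjective x
  have hgr : g (a r (st r)) = (up r (G r)).1 (a r (st r)) :=
    hg (r + 1) _ (ha r (st r))
  have hv := hval r (G r)
  have hd := hdec r (G r)
  rw [← hgr] at hv hd
  change (if g (a (e (e.symm r)) (st (e (e.symm r)))) ∈ Γ₀ then _ else _) = _
  simp only [e.apply_symm_apply]
  split_ifs with h0
  · rcases hd with hd | hd
    · exact absurd ((st r).2.1 h0) hd.1
    · exact hd.2
  · rcases hd with hd | hd
    · -- the code was created at stage `r` exactly
      have hfind : Nat.find (hex (g (a r (st r)))) = r := by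
        rw [Nat.find_eq_iff]
        exact ⟨hv, fun m hm hmem => hd.1 (hΓmono (Nat.succ_le_of_lt hm) hmem)⟩
      rw [hfind]
      exact hd.2
    · exact absurd hd.1 h0

/-- A single map can send each member of a countable family of infinite sets onto the whole
(countable) space. -/
theorem exists_surjOn_of_infinite (e : Ω ≃ ℕ) {I : Type*} [Countable I] [Nonempty I]
    (B : I → Set Ω) (hB : ∀ i, (B i).Infinite) :
    ∃ t : Ω → Ω, ∀ i y, ∃ x ∈ B i, t x = y := by
  have : Countable Ω := e.injective.countable
  have : Nonempty Ω := ⟨e.symm 0⟩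
  obtain ⟨q, hq⟩ := exists_surjective_nat (I × Ω)
  have hgt : ∀ n m : ℕ, ∃ x ∈ B (q n).1, m < e x := by
    intro n m
    obtain ⟨_, ⟨x, hx, rfl⟩, hm⟩ := ((hB (q n).1).image e.injective.injOn).exists_gt m
    exact ⟨x, hx, hm⟩
  choose nxt hmem hlt using hgt
  let x : ℕ → Ω := fun n => Nat.rec (nxt 0 0) (fun n y => nxt (n + 1) (e y)) n
  have hx : ∀ n, x n ∈ B (q n).1 := by
    rintro (_ | n)
    · exact hmem _ _
    · exact hmem _ _
  have hinj : Function.Injective x := by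
    have : StrictMono (e ∘ x) := strictMono_nat_of_lt_succ fun n => hlt (n + 1) (e (x n))
    exact this.injective.of_comp
  refine ⟨Function.extend x (fun n => (q n).2) id, fun i y => ?_⟩
  obtain ⟨n, hn⟩ := hq (i, y)
  refine ⟨x n, by simpa [hn] using hx n, ?_⟩
  rw [hinj.extend_apply, hn]

/-- If every pointwise stabilizer of a finite set has an infinite forward orbit, then two fixed maps
turn suitable elements of `M` into all self-maps. -/
theorem exists_sandwich_of_infinite_orbits (e : Ω ≃ ℕ) {M : Submonoid (Function.End Ω)}
    (hclosed : IsClosedSubmonoid M) (hdense : HasDenseAEInjective M) (hM : CondI M) :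
    ∃ s t : Function.End Ω, ∀ f : Function.End Ω, ∃ g ∈ M, t * g * s = f := by
  classical
  have : Countable Ω := e.injective.countable
  choose α hα using hM
  have hsel : ∀ (Γ : Finset Ω) (y : Ω), ∃ h ∈ stab M (Γ : Set Ω), AEInjective h ∧
      (y ∈ forwardOrbit (stab M (Γ : Set Ω)) (α Γ) → h (α Γ) = y) := by
    intro Γ y
    by_cases hy : y ∈ forwardOrbit (stab M (Γ : Set Ω)) (α Γ)
    · obtain ⟨h, hh, rfl⟩ := hy
      obtain ⟨h', hh', hAE, hagree⟩ := hasDenseAEInjective_iff.1 (hdense.stab Γ) h hh {α Γ}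
      exact ⟨h', hh', hAE, fun _ => hagree _ (Finset.mem_singleton_self _)⟩
    · exact ⟨1, one_mem _, aeInjective_one, fun h => absurd h hy⟩
  choose h hstab hAE hh using hsel
  -- All approximations are taken in a countable monoid `G` of a.e. injective maps, which is
  -- independent of the decoding map `t`.
  let G : Submonoid (Function.End Ω) :=
    Submonoid.closure (Set.range fun p : Finset Ω × Ω => h p.1 p.2)
  have hG : ∀ g ∈ G, g ∈ M ∧ AEInjective g := by
    intro g hg
    induction hg using Submonoid.closure_induction with
    | mem x hx =>
      obtain ⟨p, rfl⟩ := hx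
      exact ⟨(mem_stab.1 (hstab _ _)).1, hAE _ _⟩
    | one => exact ⟨one_mem _, aeInjective_one⟩
    | mul x y _ _ hx hy => exact ⟨mul_mem hx.1 hy.1, hx.2.mul hy.2⟩
  have : Countable G := (countable_submonoid_closure (Set.countable_range _)).to_subtype
  obtain ⟨t, ht⟩ := exists_surjOn_of_infinite e
    (fun p : G × Finset Ω => p.1.1 '' forwardOrbit (stab M (p.2 : Set Ω)) (α p.2)) (by
      rintro ⟨⟨g, hg⟩, Γ⟩ hfin
      refine hα Γ (((hG g hg).2.finite_preimage hfin).subset fun x hx => ⟨x, hx, rfl⟩))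
  let Γ : ℕ → Finset Ω := fun n => Nat.rec ∅ (fun r Γ => insert (α Γ) (insert (e.symm r) Γ)) n
  have hΓs : ∀ r, Γ (r + 1) = insert (α (Γ r)) (insert (e.symm r) (Γ r)) := fun _ => rfl
  have hΓmono : Monotone Γ := monotone_nat_of_le_succ fun r => by
    rw [hΓs]
    exact (Finset.subset_insert _ _).trans (Finset.subset_insert _ _)
  refine ⟨fun x => α (Γ (e x)), t, fun f => ?_⟩
  have hstep : ∀ (r : ℕ) (g : G), ∃ g' : G, (∀ x ∈ Γ r, g'.1 x = g.1 x) ∧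
      t (g'.1 (α (Γ r))) = f (e.symm r) := by
    intro r g
    obtain ⟨_, ⟨y, hy, rfl⟩, hty⟩ := ht (g, Γ r) (f (e.symm r))
    refine ⟨g * ⟨h (Γ r) y, Submonoid.subset_closure ⟨(Γ r, y), rfl⟩⟩, fun x hx => ?_, ?_⟩
    · exact congrArg g.1 ((mem_stab.1 (hstab (Γ r) y)).2 x hx)
    · change t (g.1 (h (Γ r) y (α (Γ r)))) = _
      rw [hh _ _ hy, hty]
  choose up hagree hdec using hstep
  let k : ℕ → G := fun n => Nat.rec 1 up n
  obtain ⟨g, hgM, hg⟩ := hclosed.exists_limit Γ hΓmono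
    (fun x => ⟨e x + 1, by rw [hΓs]; simp⟩) (fun r => (k r).1) (fun r => (hG _ (k r).2).1)
    (fun r x hx => hagree r (k r) x hx)
  refine ⟨g, hgM, funext fun x => ?_⟩
  obtain ⟨r, rfl⟩ := e.symm.surjective x
  change t (g (α (Γ (e (e.symm r))))) = _
  rw [e.apply_symm_apply, hg (r + 1) _ (by rw [hΓs]; simp)]
  exact hdec r (k r)

/-! ### Upper bounds for the monoids with small forward orbits -/

/-- Maps with a prescribed finite set of possible values at each point become decreasing after a
sparse reindexing of the domain. -/
theorem generatedOver_decreasingMonoid (e : Ω ≃ ℕ) (F : Ω → Set Ω) (hF : ∀ α, (F α).Finite) :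
    GeneratedOver {f : Function.End Ω | ∀ α, f α ∈ F α} (decreasingMonoid e) := by
  classical
  have hbd : ∀ n : ℕ, ∃ b : ℕ, ∀ y ∈ F (e.symm n), e y ≤ b := by
    intro n
    obtain ⟨b, hb⟩ := ((hF (e.symm n)).image e).bddAbove
    exact ⟨b, fun y hy => hb ⟨y, hy, rfl⟩⟩
  choose b hb using hbd
  let k : ℕ → ℕ := fun n => n + ∑ i ∈ Finset.range (n + 1), b i
  have hk : StrictMono k := strictMono_nat_of_lt_succ fun n => by
    simp only [k, Finset.sum_range_succ _ (n + 1)]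
    omega
  have hbk : ∀ n, b n ≤ k n := fun n => by
    simp only [k, Finset.sum_range_succ _ n]
    omega
  let s : Ω → Ω := fun x => e.symm (k (e x))
  have hs : Function.Injective s :=
    e.symm.injective.comp (hk.injective.comp e.injective)
  refine generatedOver_of_sandwich s (1 : Function.End Ω) fun f hf =>
    ⟨Function.extend s f id, fun x => ?_, funext fun x => hs.extend_apply f id x⟩
  by_cases hx : ∃ y, s y = x
  · obtain ⟨y, rfl⟩ := hx
    refine (congrArg e (hs.extend_apply (f : Ω → Ω) id y)).trans_le ?_
    have h₁ := hb (e y) (f y) (by rw [e.symm_apply_apply]; exact hf y)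
    simpa [s] using h₁.trans (hbk (e y))
  · exact (congrArg e (Function.extend_apply' (f : Ω → Ω) id x hx)).le

/-- A partition of a countably infinite set into pairs is the partition into the fibres of the
first coordinate, for a suitable identification with `ℕ × Bool`. -/
theorem exists_equiv_prod_bool (e : Ω ≃ ℕ) {A : Set (Set Ω)} (hA : Setoid.IsPartition A)
    (hA2 : ∀ s ∈ A, s.ncard = 2) :
    ∃ φ : Ω ≃ ℕ × Bool, ∀ f : Function.End Ω,
      f ∈ partitionMonoid A ↔ ∀ α, (φ (f α)).1 = (φ α).1 := by
  classical
  have : Countable Ω := e.injective.countable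
  have : Infinite Ω := Infinite.of_injective _ e.symm.injective
  choose a b hab hs using fun s : A => Set.ncard_eq_two.1 (hA2 s.1 s.2)
  have hmem_a : ∀ s : A, a s ∈ s.1 := fun s => by rw [hs s]; simp
  have hmem_b : ∀ s : A, b s ∈ s.1 := fun s => by rw [hs s]; simp
  have huniq : ∀ (s t : A) (x : Ω), x ∈ s.1 → x ∈ t.1 → s = t := fun s t x hxs hxt =>
    Subtype.ext ((hA.2 x).unique ⟨s.2, hxs⟩ ⟨t.2, hxt⟩)
  let ψ : A × Bool → Ω := fun p => if p.2 then a p.1 else b p.1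
  have hψmem : ∀ p, ψ p ∈ p.1.1 := by
    rintro ⟨s, _ | _⟩
    · exact hmem_b s
    · exact hmem_a s
  have hψ : Function.Bijective ψ := by
    constructor
    · rintro ⟨s, i⟩ ⟨t, j⟩ h
      obtain rfl : s = t := huniq s t _ (hψmem (s, i)) (h ▸ hψmem (t, j))
      rcases i with _ | _ <;> rcases j with _ | _
      · rfl
      · exact absurd h.symm (hab s)
      · exact absurd h (hab s)
      · rfl
    · intro x
      obtain ⟨s, ⟨hsA, hxs⟩, -⟩ := hA.2 x
      have hx : x ∈ ({a ⟨s, hsA⟩, b ⟨s, hsA⟩} : Set Ω) := hs ⟨s, hsA⟩ ▸ hxs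
      rcases hx with hx | hx
      · exact ⟨(⟨s, hsA⟩, true), hx.symm⟩
      · exact ⟨(⟨s, hsA⟩, false), hx.symm⟩
  have : Countable A := Function.Injective.countable (f := a) fun s t h =>
    huniq s t _ (hmem_a s) (h ▸ hmem_a t)
  have : Infinite A := by
    rw [← not_finite_iff_infinite]
    intro hfin
    exact not_finite_iff_infinite.2 ‹Infinite Ω› (Finite.of_surjective ψ hψ.2)
  obtain ⟨θ⟩ := nonempty_equiv_of_countable (α := A) (β := ℕ)
  let Ψ : A × Bool ≃ Ω := Equiv.ofBijective ψ hψ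
  have hΨ : ∀ (x : Ω) (s : A), (Ψ.symm x).1 = s ↔ x ∈ s.1 := by
    intro x s
    have hx : x ∈ (Ψ.symm x).1.1 := by
      have h := hψmem (Ψ.symm x)
      have h' : ψ (Ψ.symm x) = x := Ψ.apply_symm_apply x
      rwa [h'] at h
    exact ⟨fun h => h ▸ hx, fun h => huniq _ _ x hx h⟩
  refine ⟨Ψ.symm.trans (θ.prodCongr (Equiv.refl Bool)), fun f => ?_⟩
  have hfst : ∀ x, ((Ψ.symm.trans (θ.prodCongr (Equiv.refl Bool))) x).1 = θ (Ψ.symm x).1 :=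
    fun _ => rfl
  simp only [hfst, θ.injective.eq_iff]
  constructor
  · intro hf α
    exact (hΨ _ _).2 (hf _ (Ψ.symm α).1.2 ((hΨ α _).1 rfl))
  · intro hf s hsA x hx
    have h := (hΨ x ⟨s, hsA⟩).2 hx
    exact (hΨ (f x) ⟨s, hsA⟩).1 ((hf x).trans h)

/-- The monoid `E_(A)`, up to the choice of coordinates: the maps preserving the fibres of the first
coordinate of `φ`. -/
def fibreMonoid (φ : Ω ≃ ℕ × Bool) : Submonoid (Function.End Ω) :=
  preorderMonoid (fun α β => (φ β).1 = (φ α).1) (fun _ => rfl) (fun _ _ _ h₁ h₂ => h₂.trans h₁)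

theorem generatedOver_fibreMonoid_pair (e : Ω ≃ ℕ) (φ : Ω ≃ ℕ × Bool) (u v : Ω → Ω) :
    GeneratedOver {f : Function.End Ω | ∀ α, f α = u α ∨ f α = v α} (fibreMonoid φ) := by
  classical
  refine generatedOver_of_sandwich (fun α => φ.symm (e α, false))
    (fun x => if (φ x).2 then v (e.symm (φ x).1) else u (e.symm (φ x).1)) fun f hf =>
    ⟨fun x => φ.symm ((φ x).1, !decide (f (e.symm (φ x).1) = u (e.symm (φ x).1))),
      fun x => by simp, funext fun α => ?_⟩
  change (if (φ (φ.symm ((φ (φ.symm (e α, false))).1, _))).2 then _ else _) = _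
  simp only [Equiv.apply_symm_apply, Equiv.symm_apply_apply]
  by_cases h : f α = u α
  · simp [h]
  · simpa [h] using ((hf α).resolve_left h).symm

/-- A choice among `n + 2` values is a choice between two copies of the domain, followed by a choice
among `n + 1` values on one copy and no choice on the other. -/
theorem generatedOver_fibreMonoid_fin (e : Ω ≃ ℕ) (φ : Ω ≃ ℕ × Bool) (n : ℕ)
    (u : Fin (n + 1) → Ω → Ω) :
    GeneratedOver {f : Function.End Ω | ∀ α, ∃ j, f α = u j α} (fibreMonoid φ) := by
  classical
  induction n with
  | zero =>
    refine (generatedOver_singleton (E := Function.End Ω) (u 0) _).mono fun f hf =>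
      funext fun α => ?_
    obtain ⟨j, hj⟩ := hf α
    rw [hj, Fin.fin_one_eq_zero j]
  | succ n ih =>
    let p : Ω → Ω := fun x => e.symm (e x / 2)
    refine (ih fun j x => if e x % 2 = 0 then u j.castSucc (p x) else u (Fin.last _) (p x)).mul
      (generatedOver_fibreMonoid_pair e φ (fun α => e.symm (2 * e α))
        (fun α => e.symm (2 * e α + 1))) fun f hf => ?_
    refine ⟨fun x => if e x % 2 = 0 then
        (if f (p x) = u (Fin.last _) (p x) then u 0 (p x) else f (p x))
        else u (Fin.last _) (p x), fun x => ?_,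
      fun α => if f α = u (Fin.last _) α then e.symm (2 * e α + 1) else e.symm (2 * e α),
      fun α => ?_, funext fun α => ?_⟩
    · by_cases hx : e x % 2 = 0
      · by_cases hfx : f (p x) = u (Fin.last _) (p x)
        · exact ⟨0, by simp [hx, hfx]⟩
        · obtain ⟨j, hj⟩ := hf (p x)
          induction j using Fin.lastCases with
          | last => exact absurd hj hfx
          | cast j => exact ⟨j, by simp only [hx, if_true, if_neg hfx]; exact hj⟩
      · exact ⟨0, by simp [hx]⟩
    · by_cases hfα : f α = u (Fin.last _) α
      · exact Or.inr (if_pos hfα)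
      · exact Or.inl (if_neg hfα)
    · have h₁ : (2 * e α + 1) / 2 = e α := by omega
      have h₂ : (2 * e α + 1) % 2 = 1 := by omega
      by_cases hfα : f α = u (Fin.last _) α
      · change (if e (if f α = _ then _ else _) % 2 = 0 then _ else
          u _ (p (if f α = _ then _ else _))) = _
        simp [hfα, p, h₁, h₂]
      · change (if e (if f α = _ then _ else _) % 2 = 0 then (if f (p (if f α = _ then _ else _)) =
          u _ (p (if f α = _ then _ else _)) then _ else
            f (p (if f α = _ then _ else _))) else _) = _
        simp [hfα, p]

theorem generatedOver_fibreMonoid_of_encard_le (e : Ω ≃ ℕ) (φ : Ω ≃ ℕ × Bool) (F : Ω → Set Ω)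
    (n : ℕ) (hF : ∀ α, (F α).encard ≤ n) :
    GeneratedOver {f : Function.End Ω | ∀ α, f α ∈ F α} (fibreMonoid φ) := by
  have hu : ∀ α, ∃ u : Fin (n + 1) → Ω, F α ⊆ Set.range u := by
    intro α
    have hfin : (F α).Finite := Set.finite_of_encard_le_coe (hF α)
    have : Fintype (F α) := hfin.fintype
    have hcard : Fintype.card (F α) ≤ Fintype.card (Fin (n + 1)) := by
      rw [Fintype.card_fin, ← Nat.card_eq_fintype_card]
      have h := hF α
      rw [← hfin.cast_ncard_eq, Nat.cast_le] at h
      exact h.trans n.le_succ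
    obtain ⟨i⟩ := Function.Embedding.nonempty_of_card_le hcard
    refine ⟨Function.extend i (fun x => (x : Ω)) (fun _ => α), fun x hx => ⟨i ⟨x, hx⟩, ?_⟩⟩
    rw [i.injective.extend_apply]
  choose u hu using hu
  refine (generatedOver_fibreMonoid_fin e φ n fun j α => u α j).mono fun f hf α => ?_
  obtain ⟨j, hj⟩ := hu α (hf α)
  exact ⟨j, hj.symm⟩

theorem generatedOver_rhoMonoid_pair (γ c : Ω) :
    GeneratedOver {f : Function.End Ω | ∀ α, f α = α ∨ f α = c} (rhoMonoid γ) := by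
  classical
  refine generatedOver_of_sandwich (fun x => Equiv.swap γ c x) (fun x => Equiv.swap γ c x)
    fun f hf => ⟨fun x => Equiv.swap γ c (f (Equiv.swap γ c x)), fun x => ?_, funext fun x => ?_⟩
  · change Equiv.swap γ c (f (Equiv.swap γ c x)) = x ∨ Equiv.swap γ c (f (Equiv.swap γ c x)) = γ
    rcases hf (Equiv.swap γ c x) with h | h
    · left; rw [h, Equiv.swap_apply_self]
    · right; rw [h, Equiv.swap_apply_right]
  · change Equiv.swap γ c (Equiv.swap γ c (f (Equiv.swap γ c (Equiv.swap γ c x)))) = _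
    rw [Equiv.swap_apply_self, Equiv.swap_apply_self]

/-- A map that fixes the finite set `Γ` and moves points only into `Γ` is a product of maps each of
which moves points only to one fixed element of `Γ`. -/
theorem generatedOver_rhoMonoid (γ : Ω) (Γ : Finset Ω) :
    GeneratedOver {f : Function.End Ω | (∀ x ∈ Γ, f x = x) ∧ ∀ α, f α = α ∨ f α ∈ Γ}
      (rhoMonoid γ) := by
  classical
  induction Γ using Finset.induction_on with
  | empty =>
    refine (generatedOver_singleton (1 : Function.End Ω) _).mono fun f hf => funext fun α => ?_
    exact (hf.2 α).resolve_right (Finset.notMem_empty _)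
  | insert c Γ hc ih =>
    refine (generatedOver_rhoMonoid_pair γ c).mul ih fun f ⟨hfix, hf⟩ => ?_
    refine ⟨fun x => if f x = c then c else x, fun x => ?_,
      fun x => if f x = c then x else f x, ⟨fun x hx => ?_, fun x => ?_⟩, funext fun x => ?_⟩
    · by_cases h : f x = c
      · exact Or.inr (if_pos h)
      · exact Or.inl (if_neg h)
    · simp [hfix x (Finset.mem_insert_of_mem hx)]
    · by_cases h : f x = c
      · exact Or.inl (if_pos h)
      · simp only [if_neg h]
        exact (hf x).imp_right fun h' => (Finset.mem_insert.1 h').resolve_left h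
    · change (if f (if f x = c then x else f x) = c then c else (if f x = c then x else f x)) = f x
      by_cases h : f x = c
      · simp [h]
      · have hff : f (f x) = f x := by
          rcases hf x with h' | h'
          · rw [h', h']
          · exact hfix _ h'
        simp [h, hff]

/-! ### Lower bounds for the monoids with large forward orbits -/

theorem top_preceq (e : Ω ≃ ℕ) {M : Submonoid (Function.End Ω)} (hclosed : IsClosedSubmonoid M)
    (hdense : HasDenseAEInjective M) (hM : CondI M) : Preceq ⊤ M := by
  obtain ⟨s, t, h⟩ := exists_sandwich_of_infinite_orbits e hclosed hdense hM
  exact generatedOver_of_sandwich s t fun f _ => h f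

theorem preorderMonoid_preceq_of_finite_choices (e : Ω ≃ ℕ) {ρ : Ω → Ω → Prop}
    {hrefl : ∀ α, ρ α α} {htrans : ∀ α β δ, ρ α β → ρ β δ → ρ α δ}
    {N : Submonoid (Function.End Ω)} (hclosed : IsClosedSubmonoid N)
    (hdense : HasDenseAEInjective N) (hρ : ∀ β, {y | ρ β y}.Finite) (Γ₀ : Finset Ω) (t₀ : Ω → Ω)
    (step : ∀ (β : Ω) (Γ : Finset Ω) (W : Finset (Function.End Ω)),
      (∀ g ∈ W, g ∈ N ∧ AEInjective g) →
      ∃ (α : Ω) (τ : Ω → Ω), ∀ g ∈ W, ∀ y, ρ β y → ∃ h ∈ stab N (Γ : Set Ω),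
        (g (h α) ∉ Γ ∧ τ (g (h α)) = y) ∨ (g (h α) ∈ Γ₀ ∧ t₀ (g (h α)) = y)) :
    Preceq (preorderMonoid ρ hrefl htrans) N := by
  obtain ⟨s, t, h⟩ := exists_sandwich_of_finite_choices e hclosed hdense
    (fun β => {y | ρ β y}) hρ Γ₀ t₀ fun β Γ W _ hW => step β Γ W hW
  exact generatedOver_of_sandwich s t h

theorem finite_setOf_le (e : Ω ≃ ℕ) (β : Ω) : {y | e y ≤ e β}.Finite :=
  (Set.finite_Iic (e β)).preimage e.injective.injOn

/-- If the forward orbits of the stabilizers are not boundedly finite, then at each stage the images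
of one orbit under the finitely many approximations `g` are so large that, by Hall's theorem,
disjoint families of code points can be chosen in them. -/
theorem decreasingMonoid_preceq (e : Ω ≃ ℕ) {M : Submonoid (Function.End Ω)}
    (hclosed : IsClosedSubmonoid M) (hdense : HasDenseAEInjective M)
    (hM : ∀ S : Finset Ω, ¬ ∃ n : ℕ, ∀ α, (forwardOrbit (stab M (S : Set Ω)) α).encard ≤ n) :
    Preceq (decreasingMonoid e) M := by
  classical
  refine preorderMonoid_preceq_of_finite_choices e hclosed hdense (finite_setOf_le e) ∅ id
    fun β Γ W hW => ?_
  obtain ⟨B, hB⟩ := exists_common_exceptional_set W (fun g hg => (hW g hg).2) Γ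
  let C : Finset Ω := (finite_setOf_le e β).toFinset
  obtain ⟨α, hα⟩ : ∃ α, ((B.card + W.card * C.card : ℕ) : ℕ∞) <
      (forwardOrbit (stab M (Γ : Set Ω)) α).encard := by
    by_contra! hcon
    exact hM Γ ⟨_, hcon⟩
  obtain ⟨T, hT, hTcard⟩ := Set.exists_subset_encard_eq hα.le
  have hTfin : T.Finite := Set.finite_of_encard_eq_coe hTcard
  let T' : Finset Ω := hTfin.toFinset \ B
  have hT'card : W.card * C.card ≤ T'.card := by
    have h₁ : hTfin.toFinset.card = B.card + W.card * C.card := by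
      rw [← Set.ncard_eq_toFinset_card T hTfin, Set.ncard_def, hTcard, ENat.toNat_natCast]
    have h₂ : _ ≤ T'.card := Finset.le_card_sdiff B hTfin.toFinset
    omega
  have hT'B : ∀ x ∈ T', x ∉ B := fun x hx => (Finset.mem_sdiff.1 hx).2
  have hinj : ∀ g ∈ W, Set.InjOn g T' := fun g hg => (hB g hg).1.mono fun x hx => hT'B x hx
  obtain ⟨c, hc, hcmem⟩ := (Finset.all_card_le_biUnion_card_iff_exists_injective
    (fun p : W × C => T'.image p.1.1)).1 (fun P => by
      rcases P.eq_empty_or_nonempty with rfl | ⟨p, hp⟩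
      · simp
      calc P.card ≤ Fintype.card (W × C) := Finset.card_le_univ P
        _ = W.card * C.card := by simp
        _ ≤ T'.card := hT'card
        _ = (T'.image p.1.1).card := (Finset.card_image_of_injOn (hinj _ p.1.2)).symm
        _ ≤ _ := Finset.card_le_card
          (Finset.subset_biUnion_of_mem (fun p : W × C => T'.image p.1.1) hp))
  refine ⟨α, Function.extend c (fun p => (p.2 : Ω)) id, fun g hg y hy => ?_⟩
  let p : W × C := (⟨g, hg⟩, ⟨y, (finite_setOf_le e β).mem_toFinset.2 hy⟩)
  obtain ⟨x, hx, hxc⟩ := Finset.mem_image.1 (hcmem p)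
  obtain ⟨h, hh, hhα⟩ := hT (hTfin.mem_toFinset.1 (Finset.mem_sdiff.1 hx).1)
  refine ⟨h, hh, Or.inl ?_⟩
  rw [hhα]
  refine ⟨(hB g hg).2 x (hT'B x hx), ?_⟩
  change Function.extend c _ _ (p.1.1 x) = y
  rw [hxc, hc.extend_apply]

theorem finite_setOf_fst_eq (φ : Ω ≃ ℕ × Bool) (β : Ω) : {y | (φ y).1 = (φ β).1}.Finite := by
  refine (((Set.finite_singleton (φ β).1).prod Set.finite_univ).preimage
    φ.injective.injOn).subset fun y hy => ?_
  exact ⟨hy, Set.mem_univ _⟩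

/-- Let `n` be the least common bound, over all finite `S`, for the number of points outside `S` in
the forward orbits of `M_(S)`. If `S` attains `n`, then an orbit of a smaller stabilizer having `n`
points outside a larger finite set has the same points as the orbit of `M_(S)`, and every
approximation `g` permutes them. So the code does not depend on `g`; and condition (iii)
gives `2 ≤ n`. -/
theorem fibreMonoid_preceq (e : Ω ≃ ℕ) (φ : Ω ≃ ℕ × Bool) {M : Submonoid (Function.End Ω)}
    (hclosed : IsClosedSubmonoid M) (hdense : HasDenseAEInjective M) (hM : CondIII M) :
    Preceq (fibreMonoid φ) M := by
  classical
  obtain ⟨⟨S₁, n₁, -, hn₁⟩, hne⟩ := hM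
  have hex : ∃ n : ℕ, ∃ S : Finset Ω, ∀ α,
      (forwardOrbit (stab M (S : Set Ω)) α \ (S : Set Ω)).encard ≤ n :=
    ⟨n₁, S₁, fun α => (Set.encard_le_encard Set.sdiff_subset).trans (hn₁ α)⟩
  obtain ⟨S₀, hS₀⟩ := Nat.find_spec hex
  set n := Nat.find hex with hn
  have hlarge : ∀ S : Finset Ω, ∃ α,
      (n : ℕ∞) ≤ (forwardOrbit (stab M (S : Set Ω)) α \ (S : Set Ω)).encard := by
    intro S
    by_contra! hcon
    have hpos : 0 < n := by
      rcases Nat.eq_zero_or_pos n with h0 | h0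
      · have := hcon (e.symm 0)
        simp [h0] at this
      · exact h0
    refine Nat.find_min hex (m := n - 1) (by omega) ⟨S, fun α => ?_⟩
    refine Order.le_of_lt_add_one ((hcon α).trans_le ?_)
    rw [← Nat.cast_succ, Nat.cast_le]
    omega
  have htwo : 2 ≤ n := by
    obtain ⟨α, hα⟩ := hne S₀ S₀
    obtain ⟨β, hβ, hβ'⟩ := Set.not_subset.1 hα
    have hαS : α ∉ (S₀ : Set Ω) := fun h => by
      rw [forwardOrbit_stab_of_mem M h] at hβ
      exact hβ' (Or.inr hβ)
    have hpair : ({α, β} : Set Ω) ⊆ forwardOrbit (stab M (S₀ : Set Ω)) α \ (S₀ : Set Ω) := by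
      rintro x (rfl | rfl)
      · exact ⟨⟨1, one_mem _, rfl⟩, hαS⟩
      · exact ⟨hβ, fun h => hβ' (Or.inl h)⟩
    have h := (Set.encard_le_encard hpair).trans (hS₀ α)
    rw [Set.encard_pair fun h => hβ' (Or.inr h.symm)] at h
    exact_mod_cast h
  refine Preceq.trans (N := stab M (S₀ : Set Ω)) ?_ (Preceq.of_le (stab_le _ _))
  refine preorderMonoid_preceq_of_finite_choices e (hclosed.stab (S₀ : Set Ω))
    (hdense.stab S₀) (finite_setOf_fst_eq φ) ∅ id fun β Γ W hW => ?_
  obtain ⟨B, hB⟩ := exists_common_exceptional_set W (fun g hg => (hW g hg).2) (S₀ ∪ Γ)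
  obtain ⟨α, hα⟩ := hlarge (S₀ ∪ Γ ∪ B)
  set O := forwardOrbit (stab M ((S₀ ∪ Γ ∪ B : Finset Ω) : Set Ω)) α \
    ((S₀ ∪ Γ ∪ B : Finset Ω) : Set Ω) with hO
  have hsub : (S₀ : Set Ω) ⊆ ((S₀ ∪ Γ ∪ B : Finset Ω) : Set Ω) := by
    intro x hx
    simp only [Finset.coe_union]
    exact Or.inl (Or.inl hx)
  have hOO' : O ⊆ forwardOrbit (stab M (S₀ : Set Ω)) α \ (S₀ : Set Ω) :=
    Set.sdiff_subset_sdiff (forwardOrbit_mono (stab_anti M hsub) α) hsub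
  have hO'fin : (forwardOrbit (stab M (S₀ : Set Ω)) α \ (S₀ : Set Ω)).Finite :=
    Set.finite_of_encard_le_coe (hS₀ α)
  have hOeq : O = forwardOrbit (stab M (S₀ : Set Ω)) α \ (S₀ : Set Ω) :=
    (hO'fin.subset hOO').eq_of_subset_of_encard_le hOO' ((hS₀ α).trans hα)
  have hOfin : O.Finite := hO'fin.subset hOO'
  have hOB : ∀ x ∈ O, x ∉ B := fun x hx hxB => hx.2 (Finset.mem_union_right _ hxB)
  have hOΓ : ∀ x ∈ O, x ∉ Γ := fun x hx hxΓ =>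
    hx.2 (Finset.mem_union_left _ (Finset.mem_union_right _ hxΓ))
  have himage : ∀ g ∈ W, g '' O = O := by
    intro g hg
    have hmaps : g '' O ⊆ O := by
      rintro _ ⟨x, hx, rfl⟩
      rw [hOeq]
      obtain ⟨k, hk, rfl⟩ := (hOO' hx).1
      exact ⟨⟨g * k, mul_mem (hW g hg).1 hk, rfl⟩, fun h =>
        (hB g hg).2 _ (hOB _ hx) (Finset.mem_union_left _ h)⟩
    refine (hOfin.image g).eq_of_subset_of_encard_le hmaps ?_
    rw [((hB g hg).1.mono fun x hx => hOB x hx).encard_image]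
  obtain ⟨p, hp, q, hq, hpq⟩ : ∃ p ∈ O, ∃ q ∈ O, p ≠ q := by
    have : (1 : ℕ∞) < O.encard := lt_of_lt_of_le (by exact_mod_cast htwo) hα
    obtain ⟨p, q, hp, hq, hpq⟩ := Set.one_lt_encard_iff.1 this
    exact ⟨p, hp, q, hq, hpq⟩
  refine ⟨α, fun x => if x = p then φ.symm ((φ β).1, true) else φ.symm ((φ β).1, false),
    fun g hg y hy => ?_⟩
  obtain ⟨z, hz, hzy⟩ : ∃ z ∈ O,
      (if z = p then φ.symm ((φ β).1, true) else φ.symm ((φ β).1, false)) = y := by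
    rcases hb : (φ y).2 with _ | _
    · refine ⟨q, hq, ?_⟩
      rw [if_neg hpq.symm, Equiv.symm_apply_eq]
      exact Prod.ext hy.symm hb.symm
    · refine ⟨p, hp, ?_⟩
      rw [if_pos rfl, Equiv.symm_apply_eq]
      exact Prod.ext hy.symm hb.symm
  rw [← himage g hg] at hz
  obtain ⟨x, hx, rfl⟩ := hz
  obtain ⟨k, hk, rfl⟩ := hx.1
  refine ⟨k, ?_, Or.inl ⟨hOΓ _ (himage g hg ▸ ⟨_, hx, rfl⟩), hzy⟩⟩
  rw [stab_stab]
  refine stab_anti M ?_ hk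
  intro x hx
  rw [← Finset.coe_union] at hx
  exact Finset.mem_union_left _ hx

/-- By the pigeonhole principle one point `c` of `Γ` is a value to which every stabilizer of a
finite set can move some point. All approximations fix `c`, so that `c` can serve as the common code
for `γ`. -/
theorem rhoMonoid_preceq (e : Ω ≃ ℕ) (γ : Ω) {M : Submonoid (Function.End Ω)}
    (hclosed : IsClosedSubmonoid M) (hdense : HasDenseAEInjective M) (hM : CondIV M) :
    Preceq (rhoMonoid γ) M := by
  classical
  obtain ⟨⟨Γ, Δ, hΓ⟩, hne⟩ := hM
  obtain ⟨c, hc, hmove⟩ : ∃ c ∈ Γ, ∀ S : Finset Ω,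
      ∃ f ∈ stab M (S : Set Ω), ∃ α, f α = c ∧ α ≠ c := by
    by_contra! hcon
    choose! S hS using hcon
    refine hne (Δ ∪ Γ.biUnion S) (le_antisymm (fun f hf => ?_) bot_le)
    refine Submonoid.mem_bot.2 (funext fun α => ?_)
    have hfΔ : f ∈ stab M (Δ : Set Ω) := stab_anti M (by simp) hf
    rcases hΓ α ⟨f, hfΔ, rfl⟩ with h | h
    · have hfS : f ∈ stab M (S (f α) : Set Ω) := by
        refine stab_anti M (fun x hx => ?_) hf
        exact Finset.mem_union_right _ (Finset.mem_biUnion.2 ⟨f α, h, hx⟩)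
      exact (hS (f α) h f hfS α rfl).symm
    · exact h
  refine Preceq.trans (N := stab M ((insert c Δ : Finset Ω) : Set Ω)) ?_
    (Preceq.of_le (stab_le _ _))
  refine preorderMonoid_preceq_of_finite_choices e
    (hclosed.stab ((insert c Δ : Finset Ω) : Set Ω)) (hdense.stab _)
    (fun β => Set.toFinite {β, γ}) {c} (fun _ => γ) fun β S W hW => ?_
  obtain ⟨B, hB⟩ := exists_common_exceptional_set W (fun g hg => (hW g hg).2) S
  obtain ⟨k, hk, α, hkα, hαc⟩ := hmove (insert c Δ ∪ S ∪ B)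
  refine ⟨α, fun _ => β, fun g hg y hy => ?_⟩
  rcases hy with rfl | rfl
  · refine ⟨1, one_mem _, Or.inl ⟨(hB g hg).2 α fun hα => hαc ?_, rfl⟩⟩
    rw [← hkα, (mem_stab.1 hk).2 α (Finset.mem_union_right _ hα)]
  · refine ⟨k, ?_, Or.inr ⟨?_, rfl⟩⟩
    · rw [stab_stab]
      refine stab_anti M ?_ hk
      intro x hx
      rw [← Finset.coe_union] at hx
      exact Finset.mem_union_left _ hx
    · rw [hkα, (mem_stab.1 (hW g hg).1).2 c (Finset.mem_insert_self c Δ)]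
      exact Finset.mem_singleton_self c

/-! ### The five conditions are exhaustive and mutually exclusive -/

theorem stab_stab_finset [DecidableEq Ω] (M : Submonoid (Function.End Ω)) (S T : Finset Ω) :
    stab (stab M (S : Set Ω)) (T : Set Ω) = stab M ((S ∪ T : Finset Ω) : Set Ω) := by
  rw [stab_stab, Finset.coe_union]

theorem existsUnique_of_decreasing_chain {a b c d : Prop} (hba : b → a) (hcb : c → b)
    (hdc : d → c) :
    ∃! i, (![¬ a, a ∧ ¬ b, b ∧ ¬ c, c ∧ ¬ d, d] : Fin 5 → Prop) i := by
  by_cases hd : d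
  · have hc := hdc hd
    have hb := hcb hc
    have ha := hba hb
    exact ⟨4, hd, fun j hj => by fin_cases j <;> simp [*] at hj ⊢⟩
  by_cases hc : c
  · have hb := hcb hc
    have ha := hba hb
    exact ⟨3, ⟨hc, hd⟩, fun j hj => by fin_cases j <;> simp [*] at hj ⊢⟩
  by_cases hb : b
  · have ha := hba hb
    exact ⟨2, ⟨hb, hc⟩, fun j hj => by fin_cases j <;> simp [*] at hj ⊢⟩
  by_cases ha : a
  · exact ⟨1, ⟨ha, hb⟩, fun j hj => by fin_cases j <;> simp [*] at hj ⊢⟩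
  · exact ⟨0, ha, fun j hj => by fin_cases j <;> simp [*] at hj ⊢⟩

/-- The conditions cut up a chain of four statements: all orbits of some stabilizer are finite,
boundedly finite, contained in `Γ ∪ {α}` for a fixed finite `Γ`, trivial. Each of them implies the
preceding one, and a condition says where in the chain `M` first fails. -/
theorem existsUnique_condition (M : Submonoid (Function.End Ω)) : ∃! i, Condition M i := by
  let a : Prop := ∃ S : Finset Ω, ∀ α, (forwardOrbit (stab M (S : Set Ω)) α).Finite
  let b : Prop := ∃ S : Finset Ω, ∃ n : ℕ, ∀ α, (forwardOrbit (stab M (S : Set Ω)) α).encard ≤ n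
  let c : Prop := ∃ Γ Δ : Finset Ω, ∀ α, forwardOrbit (stab M (Δ : Set Ω)) α ⊆ (Γ : Set Ω) ∪ {α}
  let d : Prop := CondV M
  have hba : b → a := by
    rintro ⟨S, n, h⟩
    exact ⟨S, fun α => Set.finite_of_encard_le_coe (h α)⟩
  have hcb : c → b := by
    rintro ⟨Γ, Δ, h⟩
    refine ⟨Δ, Γ.card + 1, fun α => (Set.encard_le_encard (h α)).trans ?_⟩
    refine (Set.encard_union_le _ _).trans ?_
    rw [Set.encard_coe_eq_coe_finsetCard, Set.encard_singleton]
    push_cast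
    exact le_rfl
  have hdc : d → c := by
    rintro ⟨S, h⟩
    refine ⟨∅, S, fun α => ?_⟩
    rw [h]
    rintro _ ⟨f, hf, rfl⟩
    rw [Submonoid.mem_bot.1 hf]
    exact Or.inr rfl
  have h₁ : CondI M ↔ ¬ a := by
    simp only [CondI, a, not_exists, not_forall, Set.Infinite]
  have h₂ : CondII M ↔ a ∧ ¬ b := by
    simp only [CondII, a, b, not_exists]
  have h₃ : CondIII M ↔ b ∧ ¬ c := by
    have : (∃ (S : Finset Ω) (n : ℕ), 0 < n ∧
        ∀ α, (forwardOrbit (stab M (S : Set Ω)) α).encard ≤ n) ↔ b := by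
      constructor
      · rintro ⟨S, n, -, h⟩
        exact ⟨S, n, h⟩
      · rintro ⟨S, n, h⟩
        exact ⟨S, n + 1, n.succ_pos, fun α => (h α).trans (by exact_mod_cast n.le_succ)⟩
    simp only [CondIII, this, c, not_exists, not_forall]
  have h₄ : CondIV M ↔ c ∧ ¬ d := by
    simp only [CondIV, c, d, CondV, not_exists, ne_eq]
  have h₅ : CondV M ↔ d := Iff.rfl
  have hall : ∀ i, Condition M i ↔ (![¬ a, a ∧ ¬ b, b ∧ ¬ c, c ∧ ¬ d, d] : Fin 5 → Prop) i := by
    intro i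
    fin_cases i
    exacts [h₁, h₂, h₃, h₄, h₅]
  simp only [hall]
  exact existsUnique_of_decreasing_chain hba hcb hdc

theorem Condition.stab {M : Submonoid (Function.End Ω)} {i : Fin 5} (h : Condition M i)
    (S : Finset Ω) : Condition (stab M (S : Set Ω)) i := by
  classical
  have hle : ∀ T : Finset Ω, SelfMap.stab (SelfMap.stab M (S : Set Ω)) (T : Set Ω) ≤
      SelfMap.stab M (T : Set Ω) := fun T => by
    rw [stab_stab]
    exact stab_anti M Set.subset_union_right
  fin_cases i
  · intro T
    rw [stab_stab_finset]
    exact h (S ∪ T)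
  · obtain ⟨⟨T, hT⟩, h⟩ := h
    refine ⟨⟨T, fun α => (hT α).subset (forwardOrbit_mono (hle T) α)⟩, fun T => ?_⟩
    rw [stab_stab_finset]
    exact h (S ∪ T)
  · obtain ⟨⟨T, n, hn, hT⟩, h⟩ := h
    refine ⟨⟨T, n, hn, fun α =>
      (Set.encard_le_encard (forwardOrbit_mono (hle T) α)).trans (hT α)⟩, fun Γ T => ?_⟩
    rw [stab_stab_finset]
    exact h Γ (S ∪ T)
  · obtain ⟨⟨Γ, T, hT⟩, h⟩ := h
    refine ⟨⟨Γ, T, fun α => (forwardOrbit_mono (hle T) α).trans (hT α)⟩, fun T => ?_⟩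
    rw [stab_stab_finset]
    exact h (S ∪ T)
  · obtain ⟨T, hT⟩ := h
    exact ⟨T, le_bot_iff.1 (hT ▸ hle T)⟩

/-! ### The five representatives -/

section Preorder

variable {ρ : Ω → Ω → Prop} {hrefl : ∀ α, ρ α α} {htrans : ∀ α β δ, ρ α β → ρ β δ → ρ α δ}

theorem isClosedSubmonoid_preorderMonoid : IsClosedSubmonoid (preorderMonoid ρ hrefl htrans) := by
  refine isClosedSubmonoid_of_mem fun f hf α => ?_
  obtain ⟨g, hg, hgf⟩ := hf {α}
  rw [← hgf α (Finset.mem_singleton_self α)]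
  exact hg α

theorem hasDenseAEInjective_preorderMonoid :
    HasDenseAEInjective (preorderMonoid ρ hrefl htrans) := by
  classical
  refine hasDenseAEInjective_iff.2 fun f hf S => ⟨fun x => if x ∈ S then f x else x, fun x => ?_,
    ⟨S, fun x hx y hy hxy => ?_⟩, fun x hx => if_pos hx⟩
  · by_cases hx : x ∈ S
    · simpa [hx] using hf x
    · simpa [hx] using hrefl x
  · rw [Set.mem_compl_iff, Finset.mem_coe] at hx hy
    simpa [hx, hy] using hxy

theorem forwardOrbit_stab_preorderMonoid {S : Set Ω} {α : Ω} (hα : α ∉ S) :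
    forwardOrbit (stab (preorderMonoid ρ hrefl htrans) S) α = {β | ρ α β} := by
  classical
  ext β
  constructor
  · rintro ⟨f, hf, rfl⟩
    exact (mem_stab.1 hf).1 α
  · intro hβ
    refine ⟨fun x => if x = α then β else x, mem_stab.2 ⟨fun x => ?_, fun x hx => ?_⟩, if_pos rfl⟩
    · by_cases hx : x = α
      · simpa [hx] using hβ
      · simpa [hx] using hrefl x
    · exact if_neg fun h : x = α => hα (h ▸ hx)

theorem forwardOrbit_preorderMonoid_subset (S : Set Ω) (α : Ω) :
    forwardOrbit (stab (preorderMonoid ρ hrefl htrans) S) α ⊆ {β | ρ α β} := by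
  rintro _ ⟨f, hf, rfl⟩
  exact (mem_stab.1 hf).1 α

end Preorder

theorem top_eq_preorderMonoid :
    (⊤ : Submonoid (Function.End Ω)) =
      preorderMonoid (fun _ _ => True) (fun _ => trivial) (fun _ _ _ _ _ => trivial) :=
  (eq_top_iff.2 fun _ _ _ => trivial).symm

theorem bot_eq_preorderMonoid :
    (⊥ : Submonoid (Function.End Ω)) =
      preorderMonoid (fun α β => β = α) (fun _ => rfl) (fun _ _ _ h₁ h₂ => h₂.trans h₁) :=
  Eq.symm <| eq_bot_iff.2 fun f (hf : ∀ α, f α = α) => Submonoid.mem_bot.2 (funext hf)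

theorem exists_gt_not_mem (e : Ω ≃ ℕ) (S : Finset Ω) (n : ℕ) : ∃ α, α ∉ S ∧ n < e α := by
  obtain ⟨m, hm⟩ := (S.image e).bddAbove
  refine ⟨e.symm (m + n + 1), fun h => ?_, ?_⟩
  · have := hm (Finset.mem_coe.2 (Finset.mem_image_of_mem e h))
    rw [e.apply_symm_apply] at this
    omega
  · rw [e.apply_symm_apply]
    omega

theorem encard_setOf_le (e : Ω ≃ ℕ) (α : Ω) : {β | e β ≤ e α}.encard = e α + 1 := by
  have h : {β | e β ≤ e α} = e ⁻¹' (Finset.range (e α + 1) : Finset ℕ) := by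
    ext β
    simp
  rw [h, Set.encard_preimage_of_bijective e.bijective, Set.encard_coe_eq_coe_finsetCard,
    Finset.card_range]
  rfl

theorem encard_setOf_fst_eq (φ : Ω ≃ ℕ × Bool) (α : Ω) :
    {β | (φ β).1 = (φ α).1}.encard = 2 := by
  have h : {β | (φ β).1 = (φ α).1} = {φ.symm ((φ α).1, false), φ.symm ((φ α).1, true)} := by
    ext β
    simp only [Set.mem_ofPred_eq, Set.mem_insert_iff, Set.mem_singleton_iff, Equiv.eq_symm_apply,
      Prod.ext_iff]
    cases (φ β).2 <;> simp
  rw [h, Set.encard_pair (by simp)]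

theorem condI_top (e : Ω ≃ ℕ) : CondI (⊤ : Submonoid (Function.End Ω)) := by
  intro S
  have : Infinite Ω := Infinite.of_injective _ e.symm.injective
  obtain ⟨α, hα, -⟩ := exists_gt_not_mem e S 0
  rw [top_eq_preorderMonoid]
  refine ⟨α, ?_⟩
  rw [forwardOrbit_stab_preorderMonoid (by simpa using hα)]
  exact Set.infinite_univ

theorem condII_decreasingMonoid (e : Ω ≃ ℕ) : CondII (decreasingMonoid e) := by
  refine ⟨⟨∅, fun α => (finite_setOf_le e α).subset
    (forwardOrbit_preorderMonoid_subset _ α)⟩, ?_⟩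
  rintro S ⟨n, hn⟩
  obtain ⟨α, hα, hnα⟩ := exists_gt_not_mem e S n
  have h := hn α
  rw [decreasingMonoid, forwardOrbit_stab_preorderMonoid (by simpa using hα),
    encard_setOf_le] at h
  have h' : e α + 1 ≤ n := by exact_mod_cast h
  omega

theorem condIII_fibreMonoid (φ : Ω ≃ ℕ × Bool) : CondIII (fibreMonoid φ) := by
  classical
  refine ⟨⟨∅, 2, two_pos, fun α => ?_⟩, fun Γ Δ => ?_⟩
  · refine (Set.encard_le_encard (forwardOrbit_preorderMonoid_subset _ α)).trans ?_
    exact (encard_setOf_fst_eq φ α).le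
  · obtain ⟨n, hn⟩ := Finset.exists_notMem ((Γ ∪ Δ).image fun x => (φ x).1)
    have hnot : ∀ b, φ.symm (n, b) ∉ Γ ∪ Δ := fun b hb =>
      hn (Finset.mem_image.2 ⟨_, hb, by simp⟩)
    refine ⟨φ.symm (n, false), fun h => ?_⟩
    rw [fibreMonoid, forwardOrbit_stab_preorderMonoid
      (fun hΔ => hnot false (Finset.mem_union_right _ hΔ))] at h
    rcases h (show φ.symm (n, true) ∈ _ by simp) with h | h
    · exact hnot true (Finset.mem_union_left _ h)
    · simp at h

theorem condIV_rhoMonoid (e : Ω ≃ ℕ) (γ : Ω) : CondIV (rhoMonoid γ) := by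
  classical
  refine ⟨⟨{γ}, ∅, fun α => (forwardOrbit_preorderMonoid_subset _ α).trans ?_⟩, fun S hS => ?_⟩
  · rintro β (rfl | rfl)
    · exact Or.inr rfl
    · exact Or.inl (by simp)
  · obtain ⟨α, hα, -⟩ := exists_gt_not_mem e (insert γ S) 0
    rw [Finset.mem_insert, not_or] at hα
    have h : γ ∈ forwardOrbit (stab (rhoMonoid γ) (S : Set Ω)) α := by
      refine (forwardOrbit_stab_preorderMonoid (ρ := rho γ) ?_).ge (Or.inr rfl)
      exact fun h => hα.2 (Finset.mem_coe.1 h)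
    rw [hS] at h
    obtain ⟨f, hf, hfα⟩ := h
    rw [Submonoid.mem_bot.1 hf] at hfα
    exact hα.1 hfα

theorem condV_bot : CondV (⊥ : Submonoid (Function.End Ω)) :=
  ⟨∅, le_bot_iff.1 (stab_le _ _)⟩

/-! ### Inequivalence of the representatives -/

open Classical in
/-- The points that can be reached from `α` in `k` steps, where a step leads from `β` to a point of
`C β` or to the image of `β` under an element of `U`. -/
noncomputable def reach (C : Ω → Finset Ω) (U : Finset (Function.End Ω)) : ℕ → Ω → Finset Ω
  | 0, α => {α}
  | k + 1, α => (reach C U k α).biUnion fun β => C β ∪ U.image fun u => u β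

theorem exists_forall_mem_reach {M : Submonoid (Function.End Ω)} {C : Ω → Finset Ω}
    (hM : ∀ f ∈ M, ∀ α, f α ∈ C α) (U : Finset (Function.End Ω)) {f : Function.End Ω}
    (hf : f ∈ Submonoid.closure ((M : Set (Function.End Ω)) ∪ U)) :
    ∃ k, ∀ α, f α ∈ reach C U k α := by
  classical
  induction hf using Submonoid.closure_induction_left with
  | one => exact ⟨0, fun α => Finset.mem_singleton_self α⟩
  | mul_left x hx y _ ih =>
    obtain ⟨k, hk⟩ := ih
    refine ⟨k + 1, fun α => Finset.mem_biUnion.2 ⟨y α, hk α, ?_⟩⟩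
    rcases hx with hx | hx
    · exact Finset.mem_union_left _ (hM x hx (y α))
    · exact Finset.mem_union_right _
        (Finset.mem_image_of_mem (fun u : Function.End Ω => u (y α)) hx)

theorem card_reach_le {C : Ω → Finset Ω} {m : ℕ} (hC : ∀ α, (C α).card ≤ m)
    (U : Finset (Function.End Ω)) (k : ℕ) (α : Ω) :
    (reach C U k α).card ≤ (m + U.card) ^ k := by
  classical
  induction k with
  | zero => simp [reach]
  | succ k ih =>
    rw [pow_succ]
    refine (Finset.card_biUnion_le_card_mul _ _ (m + U.card) fun β _ => ?_).trans
      (Nat.mul_le_mul_right _ ih)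
    exact (Finset.card_union_le _ _).trans (add_le_add (hC β) Finset.card_image_le)

/-- Words of length `k` move a point to finitely many places only, so a map can avoid all of them at
the `k`-th point. -/
theorem not_top_preceq_decreasingMonoid (e : Ω ≃ ℕ) : ¬ Preceq ⊤ (decreasingMonoid e) := by
  classical
  have : Infinite Ω := Infinite.of_injective _ e.symm.injective
  rintro ⟨U, hU, h⟩
  lift U to Finset (Function.End Ω) using hU
  let C : Ω → Finset Ω := fun α => (finite_setOf_le e α).toFinset
  choose f hf using fun α => Finset.exists_notMem (reach C U (e α) α)
  have hfC : ∀ g ∈ decreasingMonoid e, ∀ α, g α ∈ C α := fun g hg α =>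
    (finite_setOf_le e α).mem_toFinset.2 (hg α)
  obtain ⟨k, hk⟩ := exists_forall_mem_reach hfC U
    (h (show (f : Function.End Ω) ∈ (⊤ : Submonoid (Function.End Ω)) from trivial))
  have hbad := hf (e.symm k)
  rw [e.apply_symm_apply] at hbad
  exact hbad (hk _)

/-- Words of length `k` over `E_(A)` and `U` move a point to at most `(2 + |U|) ^ k` places,
while the number of places to which decreasing maps can move it is unbounded. -/
theorem not_decreasingMonoid_preceq_fibreMonoid (e : Ω ≃ ℕ) (φ : Ω ≃ ℕ × Bool) :
    ¬ Preceq (decreasingMonoid e) (fibreMonoid φ) := by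
  classical
  rintro ⟨U, hU, h⟩
  lift U to Finset (Function.End Ω) using hU
  let C : Ω → Finset Ω := fun α => {φ.symm ((φ α).1, false), φ.symm ((φ α).1, true)}
  have hC : ∀ α, (C α).card ≤ 2 := fun α => Finset.card_le_two
  have hfC : ∀ f ∈ fibreMonoid φ, ∀ α, f α ∈ C α := by
    intro f hf α
    have hfα : (φ (f α)).1 = (φ α).1 := hf α
    simp only [C, Finset.mem_insert, Finset.mem_singleton, Equiv.eq_symm_apply, Prod.ext_iff, hfα]
    cases (φ (f α)).2 <;> simp
  let b := 2 + U.card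
  have hb : 1 < b := by omega
  -- The points `α` with `e α = b ^ k` serve to avoid all words of length `k`.
  have hsel : ∀ α, ∃ β, e β ≤ e α ∧ (e α = b ^ Nat.log b (e α) →
      β ∉ reach C U (Nat.log b (e α)) α) := by
    intro α
    by_cases hα : e α = b ^ Nat.log b (e α)
    · obtain ⟨β, hβ, hβ'⟩ := Finset.exists_mem_notMem_of_card_lt_card
        (s := reach C U (Nat.log b (e α)) α) (t := (finite_setOf_le e α).toFinset) (by
          have h₁ := card_reach_le hC U (Nat.log b (e α)) α
          have h₂ : (finite_setOf_le e α).toFinset.card = e α + 1 := by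
            have h₃ := encard_setOf_le e α
            rw [(finite_setOf_le e α).encard_eq_coe_toFinset_card] at h₃
            exact_mod_cast h₃
          rw [h₂]
          exact Nat.lt_succ_of_le (h₁.trans hα.ge))
      exact ⟨β, (finite_setOf_le e α).mem_toFinset.1 hβ, fun _ => hβ'⟩
    · exact ⟨α, le_rfl, fun h => absurd h hα⟩
  choose f hfle hf using hsel
  obtain ⟨k, hk⟩ := exists_forall_mem_reach hfC U
    (h (show (f : Function.End Ω) ∈ decreasingMonoid e from hfle))
  have hlog : Nat.log b (e (e.symm (b ^ k))) = k := by
    rw [e.apply_symm_apply, Nat.log_pow hb]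
  have hbad := hf (e.symm (b ^ k))
  rw [hlog, e.apply_symm_apply] at hbad
  exact hbad rfl (hk _)

/-- A word over `E(ρ_γ)` and `U` agrees with the word over `U` obtained by deletion of the factors
from `E(ρ_γ)`, except where its value is one of finitely many images of `γ`. -/
theorem exists_word_of_mem_closure_rhoMonoid {γ : Ω} {U : Set (Function.End Ω)}
    {f : Function.End Ω}
    (hf : f ∈ Submonoid.closure ((rhoMonoid γ : Set (Function.End Ω)) ∪ U)) :
    ∃ w ∈ Submonoid.closure U, ∃ F : Set Ω, F.Finite ∧ ∀ α, f α = w α ∨ f α ∈ F := by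
  induction hf using Submonoid.closure_induction_left with
  | one => exact ⟨1, one_mem _, ∅, Set.finite_empty, fun _ => Or.inl rfl⟩
  | mul_left x hx y _ ih =>
    obtain ⟨w, hw, F, hF, h⟩ := ih
    rcases hx with hx | hx
    · refine ⟨w, hw, insert γ F, hF.insert γ, fun α => ?_⟩
      change x (y α) = _ ∨ x (y α) ∈ _
      rcases hx (y α) with hxy | hxy
      · rw [hxy]
        exact (h α).imp_right fun h => Or.inr h
      · exact Or.inr (Or.inl hxy)
    · refine ⟨x * w, mul_mem (Submonoid.subset_closure hx) hw, x '' F, hF.image _, fun α => ?_⟩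
      exact (h α).imp (congrArg x) (Set.mem_image_of_mem x)

theorem not_fibreMonoid_preceq_rhoMonoid (φ : Ω ≃ ℕ × Bool) (γ : Ω) :
    ¬ Preceq (fibreMonoid φ) (rhoMonoid γ) := by
  classical
  rintro ⟨U, hU, h⟩
  obtain ⟨w, hw⟩ := (countable_submonoid_closure hU.countable).exists_eq_range
    ⟨1, one_mem (Submonoid.closure U)⟩
  -- For each `k`, the permutation `f` differs from `w k` on the infinitely many fibres with an
  -- index of the form `Nat.pair k m`.
  let c : ℕ → Bool := fun n =>
    decide (w (Nat.unpair n).1 (φ.symm (n, false)) = φ.symm (n, false))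
  let f : Function.End Ω := fun x => φ.symm ((φ x).1, xor (φ x).2 (c (φ x).1))
  have hfinj : Function.Injective f := by
    intro x y hxy
    have hxy' := φ.symm.injective hxy
    rw [Prod.ext_iff] at hxy'
    obtain ⟨h₁, h₂⟩ := hxy'
    dsimp only at h₁ h₂
    rw [h₁] at h₂
    exact φ.injective (Prod.ext h₁ (Bool.xor_left_inj.1 h₂))
  have hf : f ∈ fibreMonoid φ := fun x => by simp [f]
  obtain ⟨u, hu, F, hF, hfu⟩ := exists_word_of_mem_closure_rhoMonoid (h hf)
  obtain ⟨k, rfl⟩ : u ∈ Set.range w := hw ▸ hu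
  have hfin : {α | f α ≠ w k α}.Finite :=
    (hF.preimage hfinj.injOn).subset fun α hα => (hfu α).resolve_left hα
  refine Set.infinite_range_of_injective (f := fun m => φ.symm (Nat.pair k m, false)) ?_
    (hfin.subset ?_)
  · intro m m' hm
    have := φ.symm.injective hm
    simpa using this
  · rintro _ ⟨m, rfl⟩ heq
    by_cases hw' : w k (φ.symm (Nat.pair k m, false)) = φ.symm (Nat.pair k m, false)
    · rw [hw'] at heq
      simp [f, c, hw'] at heq
    · exact hw' (by rw [← heq]; simp [f, c, hw'])

/-- A finitely generated monoid is countable, but `E(ρ_γ)` is not. -/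
theorem not_rhoMonoid_preceq_bot (e : Ω ≃ ℕ) (γ : Ω) : ¬ Preceq (rhoMonoid γ) ⊥ := by
  classical
  rintro ⟨U, hU, h⟩
  have hcount : (((⊥ : Submonoid (Function.End Ω)) : Set (Function.End Ω)) ∪ U).Countable := by
    rw [Submonoid.coe_bot]
    exact (Set.countable_singleton _).union hU.countable
  obtain ⟨w, hw⟩ := (countable_submonoid_closure hcount).exists_eq_range ⟨1, one_mem _⟩
  -- The map `w n` is avoided at the point with number `n + (e γ + 1)`, which is not `γ`;
  -- the truncation of the subtraction at smaller numbers is harmless.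
  let f : Function.End Ω := fun x => if w (e x - (e γ + 1)) x = γ then x else γ
  have hf : f ∈ rhoMonoid γ := by
    intro x
    by_cases hx : w (e x - (e γ + 1)) x = γ
    · exact Or.inl (if_pos hx)
    · exact Or.inr (if_neg hx)
  obtain ⟨n, hn⟩ : f ∈ Set.range w := hw ▸ h hf
  set x := e.symm (n + (e γ + 1)) with hx
  have hex : e x - (e γ + 1) = n := by rw [hx, e.apply_symm_apply]; omega
  have hxγ : x ≠ γ := by
    intro hxγ
    have := congrArg e hxγ
    rw [hx, e.apply_symm_apply] at this
    omega
  have hval : w n x = if w n x = γ then x else γ := by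
    conv_lhs => rw [hn]
    simp only [f, hex]
  split_ifs at hval with hcase
  · exact hxγ (hval.symm.trans hcase)
  · exact hcase hval

/-! ### The classification -/

theorem partitionMonoid_eq_fibreMonoid (e : Ω ≃ ℕ) {A : Set (Set Ω)} (hA : Setoid.IsPartition A)
    (hA2 : ∀ s ∈ A, s.ncard = 2) : ∃ φ : Ω ≃ ℕ × Bool, partitionMonoid A = fibreMonoid φ := by
  obtain ⟨φ, hφ⟩ := exists_equiv_prod_bool e hA hA2
  exact ⟨φ, SetLike.ext hφ⟩

section Classification

variable (e : Ω ≃ ℕ) {A : Set (Set Ω)} (γ : Ω) (φ : Ω ≃ ℕ × Bool)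

theorem representative_closed_dense (hφ : partitionMonoid A = fibreMonoid φ)
    (i : Fin 5) :
    IsClosedSubmonoid (representative e A γ i) ∧ HasDenseAEInjective (representative e A γ i) := by
  have h : ∀ {ρ : Ω → Ω → Prop} {hrefl : ∀ α, ρ α α} {htrans : ∀ α β δ, ρ α β → ρ β δ → ρ α δ},
      IsClosedSubmonoid (preorderMonoid ρ hrefl htrans) ∧
        HasDenseAEInjective (preorderMonoid ρ hrefl htrans) :=
    ⟨isClosedSubmonoid_preorderMonoid, hasDenseAEInjective_preorderMonoid⟩
  fin_cases i
  · change IsClosedSubmonoid ⊤ ∧ HasDenseAEInjective ⊤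
    rw [top_eq_preorderMonoid]
    exact h
  · change IsClosedSubmonoid (decreasingMonoid e) ∧ HasDenseAEInjective (decreasingMonoid e)
    exact h
  · change IsClosedSubmonoid (partitionMonoid A) ∧ HasDenseAEInjective (partitionMonoid A)
    rw [hφ]
    exact h
  · change IsClosedSubmonoid (rhoMonoid γ) ∧ HasDenseAEInjective (rhoMonoid γ)
    exact h
  · change IsClosedSubmonoid ⊥ ∧ HasDenseAEInjective ⊥
    rw [bot_eq_preorderMonoid]
    exact h

theorem condition_representative (hφ : partitionMonoid A = fibreMonoid φ)
    (i : Fin 5) : Condition (representative e A γ i) i := by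
  fin_cases i
  · exact condI_top e
  · exact condII_decreasingMonoid e
  · change CondIII (partitionMonoid A)
    rw [hφ]
    exact condIII_fibreMonoid φ
  · exact condIV_rhoMonoid e γ
  · exact condV_bot

theorem representative_preceq (hφ : partitionMonoid A = fibreMonoid φ)
    {M : Submonoid (Function.End Ω)} (hclosed : IsClosedSubmonoid M)
    (hdense : HasDenseAEInjective M) {i : Fin 5} (hM : Condition M i) :
    Preceq (representative e A γ i) M := by
  fin_cases i
  · exact top_preceq e hclosed hdense hM
  · exact decreasingMonoid_preceq e hclosed hdense hM.2
  · change Preceq (partitionMonoid A) M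
    rw [hφ]
    exact fibreMonoid_preceq e φ hclosed hdense hM
  · exact rhoMonoid_preceq e γ hclosed hdense hM
  · exact Preceq.of_le bot_le

theorem preceq_representative (hφ : partitionMonoid A = fibreMonoid φ)
    {M : Submonoid (Function.End Ω)} (hlarge : HasLargeStabilizers M)
    {i : Fin 5} (hM : Condition M i) : Preceq M (representative e A γ i) := by
  classical
  fin_cases i
  · exact Preceq.of_le le_top
  · obtain ⟨⟨S, hS⟩, -⟩ := hM
    refine (hlarge S).2.trans ((generatedOver_decreasingMonoid e _ hS).mono ?_)
    exact fun f hf α => ⟨f, hf, rfl⟩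
  · obtain ⟨⟨S, n, -, hS⟩, -⟩ := hM
    change Preceq M (partitionMonoid A)
    rw [hφ]
    refine (hlarge S).2.trans ((generatedOver_fibreMonoid_of_encard_le e φ _ n hS).mono ?_)
    exact fun f hf α => ⟨f, hf, rfl⟩
  · obtain ⟨⟨Γ, Δ, hΓ⟩, -⟩ := hM
    -- The stabilizer is taken so small that it also fixes the exceptional set `Γ`.
    refine (hlarge (Γ ∪ Δ)).2.trans ((generatedOver_rhoMonoid γ Γ).mono fun f hf => ⟨?_, ?_⟩)
    · exact fun x hx => (mem_stab.1 hf).2 x (Finset.mem_union_left _ hx)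
    · intro α
      have hfΔ : f ∈ stab M (Δ : Set Ω) := stab_anti M (by simp) hf
      exact (hΓ α ⟨f, hfΔ, rfl⟩).symm
  · obtain ⟨S, hS⟩ := hM
    have h := (hlarge S).2
    rwa [hS] at h

theorem admissible_representative (hφ : partitionMonoid A = fibreMonoid φ)
    (i : Fin 5) : Admissible (representative e A γ i) := by
  obtain ⟨hclosed, hdense⟩ := representative_closed_dense e γ φ hφ i
  exact ⟨hclosed, fun S => ⟨Preceq.of_le (stab_le _ _),
    representative_preceq e γ φ hφ (hclosed.stab S) (hdense.stab S)
      ((condition_representative e γ φ hφ i).stab S)⟩, hdense⟩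

theorem not_preceq_representative_of_lt (hφ : partitionMonoid A = fibreMonoid φ)
    {i j : Fin 5} (hij : i < j) :
    ¬ Preceq (representative e A γ i) (representative e A γ j) := by
  have h₁ : Preceq (decreasingMonoid e) ⊤ := Preceq.of_le le_top
  have h₂ : Preceq (fibreMonoid φ) (decreasingMonoid e) :=
    (generatedOver_decreasingMonoid e _ (finite_setOf_fst_eq φ)).mono fun f hf α => hf α
  have h₃ : Preceq (rhoMonoid γ) (fibreMonoid φ) :=
    (generatedOver_fibreMonoid_pair e φ id fun _ => γ).mono fun f hf α => hf α
  have h₄ : Preceq ⊥ (rhoMonoid γ) := Preceq.of_le bot_le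
  have hdown : ∀ k : Fin 4, Preceq (representative e A γ k.succ) (representative e A γ k.castSucc) ∧
      ¬ Preceq (representative e A γ k.castSucc) (representative e A γ k.succ) := by
    intro k
    fin_cases k
    · exact ⟨h₁, not_top_preceq_decreasingMonoid e⟩
    · change Preceq (partitionMonoid A) (decreasingMonoid e) ∧
        ¬ Preceq (decreasingMonoid e) (partitionMonoid A)
      rw [hφ]
      exact ⟨h₂, not_decreasingMonoid_preceq_fibreMonoid e φ⟩
    · change Preceq (rhoMonoid γ) (partitionMonoid A) ∧ ¬ Preceq (partitionMonoid A) (rhoMonoid γ)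
      rw [hφ]
      exact ⟨h₃, not_fibreMonoid_preceq_rhoMonoid φ γ⟩
    · exact ⟨h₄, not_rhoMonoid_preceq_bot e γ⟩
  let r (M N : Submonoid (Function.End Ω)) : Prop := Preceq N M ∧ ¬ Preceq M N
  have : IsTrans (Submonoid (Function.End Ω)) r :=
    ⟨fun _ _ _ h h' => ⟨h'.1.trans h.1, fun hc => h.2 (hc.trans h'.1)⟩⟩
  exact ((Fin.liftFun_iff_succ r).2 hdown hij).2

theorem not_approx_representative (hφ : partitionMonoid A = fibreMonoid φ)
    {i j : Fin 5} (hij : i ≠ j) :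
    ¬ Approx (representative e A γ i) (representative e A γ j) := by
  intro h
  rcases lt_or_gt_of_ne hij with hlt | hlt
  · exact not_preceq_representative_of_lt e γ φ hφ hlt h.1
  · exact not_preceq_representative_of_lt e γ φ hφ hlt h.2

theorem approx_representative_iff (hφ : partitionMonoid A = fibreMonoid φ)
    {M : Submonoid (Function.End Ω)} (hM : Admissible M)
    (i : Fin 5) : Approx M (representative e A γ i) ↔ Condition M i := by
  have hcond : ∀ j, Condition M j → Approx M (representative e A γ j) := fun j hj =>
    ⟨preceq_representative e γ φ hφ hM.largeStabilizers hj,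
      representative_preceq e γ φ hφ hM.closed hM.denseAEInjective hj⟩
  refine ⟨fun h => ?_, hcond i⟩
  obtain ⟨j, hj, -⟩ := existsUnique_condition M
  rcases eq_or_ne i j with rfl | hij
  · exact hj
  · exact absurd (h.symm.trans (hcond j hj)) (not_approx_representative e γ φ hφ hij)

end Classification

end SelfMap

theorem theorem9p1 {Ω : Type*} [Countable Ω] [Infinite Ω]
    (e : Ω ≃ ℕ) (A : Set (Set Ω)) (hA : Setoid.IsPartition A) (hA2 : ∀ s ∈ A, s.ncard = 2)
    (γ : Ω) :
    -- the five representatives belong to the family that is classified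
    (∀ i, SelfMap.Admissible (SelfMap.representative e A γ i)) ∧
    -- they are pairwise inequivalent
    (∀ i j, i ≠ j →
      ¬ SelfMap.Approx (SelfMap.representative e A γ i) (SelfMap.representative e A γ j)) ∧
    -- every member lies in exactly one of the five classes, as decided by the five conditions
    ∀ M : Submonoid (Function.End Ω), SelfMap.Admissible M →
      (∃! i, SelfMap.Approx M (SelfMap.representative e A γ i)) ∧
      (∃! i, SelfMap.Condition M i) ∧
      (∀ i, SelfMap.Approx M (SelfMap.representative e A γ i) ↔ SelfMap.Condition M i) := by
  obtain ⟨φ, hφ⟩ := SelfMap.partitionMonoid_eq_fibreMonoid e hA hA2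
  refine ⟨SelfMap.admissible_representative e γ φ hφ,
    fun i j => SelfMap.not_approx_representative e γ φ hφ, fun M hM => ?_⟩
  have hiff := SelfMap.approx_representative_iff e γ φ hφ hM
  exact ⟨(existsUnique_congr fun i => hiff i).2 (SelfMap.existsUnique_condition M),
    SelfMap.existsUnique_condition M, hiff⟩
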